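/- Let $(V,\in)$ be any model of $ZF$ (no form of choice is assumed in $V$). For a class $X$ of $V$, let $OD(X)$ be the class of all sets $a$ that are definable from ordinals and elements of $X$, that is, for which there are a formula $\varphi(v,v_1,\dots,v_n)$ of the language $\{\in\}$ and parameters $p_1,\dots,p_n$, each an ordinal or an element of $X$, such that $a$ is the unique element of $V$ with $V\models\varphi(a,p_1,\dots,p_n)$. Let $HOD(X)$ be the class of all sets $a$ such that every element of the transitive closure of $\{a\}$ belongs to $OD(X)$, and let $HOD=HOD(\emptyset)$. An inner model is a transitive class $M$ that contains all ordinals, is a model of $ZF$, and is such that the axioms of $ZF$ remain valid in $V$ when the axiom schemes are applied to formulas with an additional unary predicate interpreted by $M$. Then: (a) $HOD$ satisfies the axiom of choice. (b) If $M$ is an inner model that satisfies the axiom of choice, then $HOD(M)$ satisfies the axiom of choice. -/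

import Mathlib

/-! Models of set theory are structures `(V, E)`, where `E y x` is read "`y` is an element of `x`".
The universe of sets is an arbitrary model of `ZF`; no form of choice is assumed about it. -/

namespace SetModel

/-- The relation symbols of the language of set theory: one binary symbol. -/
inductive MemRel : ℕ → Type
  | mem : MemRel 2

/-- The language `{∈}` of set theory. -/
def langMem : FirstOrder.Language.{0, 0} := ⟨fun _ => Empty, MemRel⟩

/-- The relation symbols of the language of set theory with one unary predicate symbol `U`. -/
inductive MemPredRel : ℕ → Type
  | mem : MemPredRel 2
  | pred : MemPredRel 1

/-- The language `{∈, U}`. -/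
def langMemPred : FirstOrder.Language.{0, 0} := ⟨fun _ => Empty, MemPredRel⟩

section

variable {V : Type*}

/-- The structure `(V, E)` for the language `{∈}`. -/
@[reducible] def memStructure (E : V → V → Prop) : langMem.Structure V where
  funMap := fun f _ => nomatch f
  RelMap := fun r v =>
    match r, v with
    | MemRel.mem, v => E (v 0) (v 1)

/-- The structure `(V, E, M)` for the language `{∈, U}`; the predicate `U` is interpreted by `M`. -/
@[reducible] def memPredStructure (E : V → V → Prop) (M : Set V) : langMemPred.Structure V where
  funMap := fun f _ => nomatch f
  RelMap := fun r v =>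
    match r, v with
    | MemPredRel.mem, v => E (v 0) (v 1)
    | MemPredRel.pred, v => v 0 ∈ M

/-- `(V, E)` satisfies the axioms of `ZF`, where separation and replacement are applied to all
formulas of the language `L` (with arbitrary parameters from `V`). Thus `P` and `R` below range
over the subclasses of `V` and of `V × V` that some `L`-formula defines from parameters. -/
structure SatisfiesZFIn (L : FirstOrder.Language.{0, 0}) [L.Structure V] (E : V → V → Prop) : Prop where
  extensionality : ∀ x y, (∀ z, E z x ↔ E z y) → x = y
  foundation : ∀ x, (∃ y, E y x) → ∃ y, E y x ∧ ∀ z, E z y → ¬ E z x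
  pairing : ∀ x y, ∃ p, ∀ z, E z p ↔ z = x ∨ z = y
  union : ∀ x, ∃ u, ∀ z, E z u ↔ ∃ y, E y x ∧ E z y
  powerset : ∀ x, ∃ p, ∀ y, E y p ↔ ∀ z, E z y → E z x
  infinity : ∃ w, (∃ e, E e w ∧ ∀ z, ¬ E z e) ∧
    ∀ x, E x w → ∃ s, E s w ∧ ∀ z, E z s ↔ E z x ∨ z = x
  separation : ∀ P : Set V, (Set.univ : Set V).Definable₁ L P →
    ∀ a, ∃ b, ∀ x, E x b ↔ E x a ∧ x ∈ P
  replacement : ∀ R : Set (V × V), (Set.univ : Set V).Definable₂ L R →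
    ∀ a, (∀ x, E x a → ∀ y y', (x, y) ∈ R → (x, y') ∈ R → y = y') →
      ∃ b, ∀ y, E y b ↔ ∃ x, E x a ∧ (x, y) ∈ R

/-- `(V, E)` is a model of `ZF`. -/
def SatisfiesZF (E : V → V → Prop) : Prop :=
  letI := memStructure E
  SatisfiesZFIn langMem E

/-- `p` is the unordered pair `{a, b}`. -/
def IsPair (E : V → V → Prop) (p a b : V) : Prop :=
  ∀ z, E z p ↔ z = a ∨ z = b

/-- `p` is the ordered pair `(a, b) = {{a}, {a, b}}`. -/
def IsOrderedPair (E : V → V → Prop) (p a b : V) : Prop :=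
  ∃ s t, IsPair E s a a ∧ IsPair E t a b ∧ IsPair E p s t

/-- `(V, E)` satisfies the axiom of choice: for every set `x` of nonempty sets there is a function
`f` with domain `x` such that `f(y) ∈ y` for all `y ∈ x`. -/
def SatisfiesAC (E : V → V → Prop) : Prop :=
  ∀ x, (∀ y, E y x → ∃ z, E z y) →
    ∃ f, (∀ p, E p f → ∃ y z, E y x ∧ E z y ∧ IsOrderedPair E p y z) ∧
      ∀ y, E y x → ∃! z, ∃ p, E p f ∧ IsOrderedPair E p y z

/-- The membership relation of the submodel `(M, E ↾ M)`. -/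
def restrict (E : V → V → Prop) (M : Set V) : M → M → Prop :=
  fun y x => E y x

/-- `t` is a transitive set. -/
def IsTransSet (E : V → V → Prop) (t : V) : Prop :=
  ∀ x, E x t → ∀ y, E y x → E y t

/-- `a` is an ordinal: a transitive set of transitive sets. (In the presence of the axiom of
foundation this amounts to: transitive and well-ordered by membership.) -/
def IsOrd (E : V → V → Prop) (a : V) : Prop :=
  IsTransSet E a ∧ ∀ x, E x a → IsTransSet E x

/-- The class of all ordinals of `(V, E)`. -/
def ordinals (E : V → V → Prop) : Set V := {a | IsOrd E a}

/-- `M` is an inner model of `ZF` in `(V, E)`. -/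
structure IsInnerModel (E : V → V → Prop) (M : Set V) : Prop where
  /-- `M` is a class of `V`: the axioms of `ZF` hold in `V` also when the schemes are applied to
  formulas with a predicate for `M`. -/
  isClass : letI := memPredStructure E M; SatisfiesZFIn langMemPred E
  transitive : ∀ x ∈ M, ∀ y, E y x → y ∈ M
  ordinals_subset : ordinals E ⊆ M
  satisfiesZF : SatisfiesZF (restrict E M)

/-- `OD(X)`: the elements `a` of `V` such that, for some formula `φ` of the language `{∈}` and
finitely many parameters, each of them an ordinal or an element of `X`, `a` is the only element
of `V` that satisfies `φ` in `(V, E)`. -/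
def OD (E : V → V → Prop) (X : Set V) : Set V :=
  letI := memStructure E
  {a | (ordinals E ∪ X).Definable₁ langMem {a}}

/-- `t` is the transitive closure of `{a}` in `(V, E)`: the least transitive set that contains
`a` as an element. -/
def IsTclSingleton (E : V → V → Prop) (t a : V) : Prop :=
  (IsTransSet E t ∧ E a t) ∧ ∀ s, IsTransSet E s → E a s → ∀ x, E x t → E x s

/-- `HOD(X)`: the elements `a` such that every element of the transitive closure of `{a}` is in
`OD(X)`. -/
def HOD (E : V → V → Prop) (X : Set V) : Set V :=
  {a | ∃ t, IsTclSingleton E t a ∧ ∀ x, E x t → x ∈ OD E X}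

end

end SetModel

/-! Fix a parameter p and close the ordinals together with p under a finite list of explicit
operations on sets: levels of the cumulative hierarchy, products, differences, domains, ranges,
projections and the like. A recursion along the ordinals lists this closure, `generated E p`, as the
values of a function definable from p (`enum`, `exists_enum_eq`). So the closure has a definable
well-ordering by least index, with no quantification over formulas.

The closure contains everything definable from ordinals and p (`mem_generated_of_definable`). By
external induction on a formula, the set of tuples from a level V_α that satisfy it in V is
generated, for every α. The quantifier step `hasLocus_all` uses collection to pass to a level with
enough counterexamples; this takes the place of reflection and of coding formulas. If x ∈ V_α is the
only solution of a formula, this set of tuples yields {x}, hence x.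

Now let x ∈ HOD(X), and suppose that all elements of members of x are generated from one w ∈ OD(X).
Picking from each member the element of least index gives a choice function definable from x and w,
and it lies in HOD(X) (`exists_choice_mem_HOD`, `satisfiesAC_HOD`). For (a) any ordinal serves as w.
For (b), each element of OD(M) is generated from a single p ∈ M, since finitely many parameters can
be paired up. Collection confines the needed p to one level of the hierarchy of M, and choice in M
gives a function w ∈ M on ordinals whose values include that level. Each such p is generated from w,
hence so is all that p generates (`IsInnerModel.exists_common_parameter`). -/

open FirstOrder FirstOrder.Language Set

namespace SetModel

/-! ### Definable relations and functions, with definability proofs left to instance search. -/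

section Definability

/-- A family of relations on `V`, of all finite arities, that contains membership and equality and
is closed under the first-order operations. -/
structure DefSys {V : Type*} (E : V → V → Prop) where
  Def : ∀ {n : ℕ}, ((Fin n → V) → Prop) → Prop
  mem : ∀ {n : ℕ} (i j : Fin n), Def fun v => E (v i) (v j)
  eq : ∀ {n : ℕ} (i j : Fin n), Def fun v => v i = v j
  not : ∀ {n : ℕ} {P : (Fin n → V) → Prop}, Def P → Def fun v => ¬ P v
  and : ∀ {n : ℕ} {P Q : (Fin n → V) → Prop}, Def P → Def Q → Def fun v => P v ∧ Q v
  ex : ∀ {n : ℕ} {P : (Fin n → V) → V → Prop},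
    Def (fun w : Fin (n + 1) → V => P (fun i => w i.succ) (w 0)) → Def fun v => ∃ x, P v x
  subst : ∀ {n m : ℕ} (σ : Fin n → Fin m) {P : (Fin n → V) → Prop},
    Def P → Def fun v : Fin m → V => P fun i => v (σ i)

variable {V : Type*} {E : V → V → Prop} {n : ℕ}

/-- The relation `P` belongs to the family `𝔇`. -/
class Dfn (𝔇 : DefSys E) (P : (Fin n → V) → Prop) : Prop where
  out : 𝔇.Def P

/-- The graph of the function `f` belongs to the family `𝔇`. -/
class DfnFun (𝔇 : DefSys E) (f : (Fin n → V) → V) : Prop where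
  out : Dfn 𝔇 fun w : Fin (n + 1) → V => w 0 = f fun i => w i.succ

variable {𝔇 : DefSys E}

section Logic

theorem Dfn.congr {P Q : (Fin n → V) → Prop} (h : Dfn 𝔇 P) (e : ∀ v, Q v ↔ P v) : Dfn 𝔇 Q := by
  rwa [show Q = P from funext fun v => propext (e v)]

instance Dfn.not (P : (Fin n → V) → Prop) [h : Dfn 𝔇 P] : Dfn 𝔇 fun v => ¬ P v := ⟨𝔇.not h.out⟩

instance Dfn.and (P Q : (Fin n → V) → Prop) [h : Dfn 𝔇 P] [h' : Dfn 𝔇 Q] :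
    Dfn 𝔇 fun v => P v ∧ Q v := ⟨𝔇.and h.out h'.out⟩

instance Dfn.ex (P : (Fin n → V) → V → Prop)
    [h : Dfn 𝔇 (fun w : Fin (n + 1) → V => P (fun i => w i.succ) (w 0))] :
    Dfn 𝔇 fun v => ∃ x, P v x := ⟨𝔇.ex h.out⟩

instance Dfn.or (P Q : (Fin n → V) → Prop) [Dfn 𝔇 P] [Dfn 𝔇 Q] :
    Dfn 𝔇 fun v => P v ∨ Q v :=
  Dfn.congr (P := fun v => ¬ (¬ P v ∧ ¬ Q v)) inferInstance fun v => by tauto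

instance Dfn.imp (P Q : (Fin n → V) → Prop) [Dfn 𝔇 P] [Dfn 𝔇 Q] :
    Dfn 𝔇 fun v => P v → Q v :=
  Dfn.congr (P := fun v => ¬ (P v ∧ ¬ Q v)) inferInstance fun v => by tauto

instance Dfn.iff (P Q : (Fin n → V) → Prop) [Dfn 𝔇 P] [Dfn 𝔇 Q] :
    Dfn 𝔇 fun v => P v ↔ Q v :=
  Dfn.congr (P := fun v => (P v → Q v) ∧ (Q v → P v)) inferInstance fun v => by tauto

instance Dfn.all (P : (Fin n → V) → V → Prop)
    [h : Dfn 𝔇 (fun w : Fin (n + 1) → V => P (fun i => w i.succ) (w 0))] :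
    Dfn 𝔇 fun v => ∀ x, P v x :=
  Dfn.congr (P := fun v => ¬ ∃ x, ¬ P v x) inferInstance fun v => by push Not; rfl

instance DfnFun.var (i : Fin n) : DfnFun 𝔇 fun v => v i := ⟨⟨𝔇.eq 0 i.succ⟩⟩

instance (priority := 10) DfnFun.subst {m : ℕ} (f : (Fin n → V) → V) (σ : Fin n → Fin m)
    [h : DfnFun 𝔇 f] : DfnFun 𝔇 fun w : Fin m → V => f fun i => w (σ i) := by
  refine ⟨⟨?_⟩⟩
  have := 𝔇.subst (m := m + 1) (Fin.cons 0 fun i => (σ i).succ) h.out.out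
  simpa using this

/-- The language has no function symbols, so a term is eliminated by quantifying over its value.
Every substitution of terms below reduces to this. -/
theorem Dfn.bind (f : (Fin n → V) → V) (P : (Fin n → V) → V → Prop) [h : DfnFun 𝔇 f]
    [h' : Dfn 𝔇 (fun w : Fin (n + 1) → V => P (fun i => w i.succ) (w 0))] :
    Dfn 𝔇 fun v => P v (f v) := by
  have := h.out
  exact Dfn.congr (P := fun v => ∃ x, x = f v ∧ P v x) inferInstance fun v => by simp

instance Dfn.eq (f g : (Fin n → V) → V) [h : DfnFun 𝔇 f] [h' : DfnFun 𝔇 g] :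
    Dfn 𝔇 fun v => f v = g v := by
  have := h'.out
  exact Dfn.bind f fun v x => x = g v

instance Dfn.mem (f g : (Fin n → V) → V) [h : DfnFun 𝔇 f] [h' : DfnFun 𝔇 g] :
    Dfn 𝔇 fun v => E (f v) (g v) := by
  have : Dfn 𝔇 fun w : Fin (n + 1) → V => E (w 0) (g fun i => w i.succ) := by
    have : Dfn 𝔇 fun w : Fin (n + 2) → V => E (w (Fin.succ 0)) (w 0) := ⟨𝔇.mem _ _⟩
    exact Dfn.bind (fun w : Fin (n + 1) → V => g fun i => w i.succ) fun w x => E (w 0) x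
  exact Dfn.bind f fun v x => E x (g v)

instance Dfn.const (p : Prop) : Dfn 𝔇 fun _ : Fin n → V => p := by
  by_cases hp : p
  · exact Dfn.congr (P := fun _ => ∀ x : V, x = x) inferInstance fun v => by simp [hp]
  · exact Dfn.congr (P := fun _ => ¬ ∀ x : V, x = x) inferInstance fun v => by simp [hp]

/-- The index is external, so this is a finite disjunction; it serves the case distinction in
`combOp`. -/
instance Dfn.finEx {k : ℕ} (P : Fin k → (Fin n → V) → Prop) [∀ i, Dfn 𝔇 (P i)] :
    Dfn 𝔇 fun v => ∃ i, P i v := by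
  induction k with
  | zero => simp; infer_instance
  | succ k ih => simp only [Fin.exists_fin_succ]; have := ih fun i => P i.succ; infer_instance

instance Dfn.transSet (f : (Fin n → V) → V) [DfnFun 𝔇 f] : Dfn 𝔇 fun v => IsTransSet E (f v) := by
  unfold IsTransSet; infer_instance

instance Dfn.isOrd (f : (Fin n → V) → V) [DfnFun 𝔇 f] : Dfn 𝔇 fun v => IsOrd E (f v) := by
  unfold IsOrd; infer_instance

end Logic

section Systems

variable (L : FirstOrder.Language.{0, 0}) [L.Structure V] (A : Set V)

/-- The relations that are definable from parameters in `A` by formulas of a language that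
expresses membership. -/
def DefSys.ofLang (h : A.Definable L {v : Fin 2 → V | E (v 0) (v 1)}) : DefSys E where
  Def P := A.Definable L {v | P v}
  mem i j := h.preimage_comp ![i, j]
  eq i j := ⟨(Term.var i).equal (Term.var j), by ext; simp⟩
  not h := h.compl
  and h h' := h.inter h'
  ex {n P} h := by
    convert h.image_comp Fin.succ using 1
    ext v
    simp only [mem_ofPred_eq, mem_image]
    refine ⟨fun ⟨x, hx⟩ => ⟨Fin.cons x v, by simpa using hx, by ext i; simp⟩, ?_⟩
    rintro ⟨w, hw, rfl⟩
    exact ⟨w 0, hw⟩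
  subst σ P h := h.preimage_comp σ

theorem DefSys.ofLang_const {h : A.Definable L {v : Fin 2 → V | E (v 0) (v 1)}} {a : V}
    (ha : a ∈ A) : DfnFun (DefSys.ofLang (E := E) L A h) fun _ : Fin n → V => a :=
  ⟨⟨(Definable.singleton_of_mem L ha).preimage_comp fun _ : Fin 1 => (0 : Fin (n + 1))⟩⟩

theorem definable_mem : letI := memStructure E
    A.Definable langMem {v : Fin 2 → V | E (v 0) (v 1)} :=
  letI := memStructure E
  ⟨Relations.formula₂ (L := langMem[[A]]) (Sum.inl MemRel.mem) (Term.var 0) (Term.var 1), by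
    ext v; simp; rfl⟩

variable (E) in
/-- The relations that are definable in `(V, E)` from parameters in `A`. -/
def paramSys : DefSys E :=
  letI := memStructure E
  DefSys.ofLang langMem A (definable_mem A)

variable (E) in
/-- The relations that are definable in `(V, E)` from arbitrary parameters. -/
def fullSys : DefSys E := paramSys E univ

theorem paramSys_const {a : V} (ha : a ∈ A) :
    DfnFun (paramSys E A) fun _ : Fin n → V => a :=
  letI := memStructure E
  DefSys.ofLang_const langMem A ha

instance fullSys_const (a : V) : DfnFun (fullSys E) fun _ : Fin n → V => a :=
  paramSys_const univ (mem_univ a)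

variable (M : Set V)

theorem definable_mem_pred : letI := memPredStructure E M
    A.Definable langMemPred {v : Fin 2 → V | E (v 0) (v 1)} :=
  letI := memPredStructure E M
  ⟨Relations.formula₂ (L := langMemPred[[A]]) (Sum.inl MemPredRel.mem) (Term.var 0) (Term.var 1),
    by ext v; simp; rfl⟩

variable (E) in
/-- The relations that are definable in `(V, E, M)` from arbitrary parameters. -/
def predSys : DefSys E :=
  letI := memPredStructure E M
  DefSys.ofLang langMemPred univ (definable_mem_pred univ M)

instance predSys_const (a : V) : DfnFun (predSys E M) fun _ : Fin n → V => a :=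
  letI := memPredStructure E M
  DefSys.ofLang_const langMemPred univ (mem_univ a)

theorem predSys_pred : Dfn (predSys E M) fun v : Fin 1 → V => v 0 ∈ M :=
  letI := memPredStructure E M
  ⟨⟨Relations.formula₁ (L := langMemPred[[(univ : Set V)]]) (Sum.inl MemPredRel.pred) (Term.var 0),
    by ext v; simp; rfl⟩⟩

theorem Dfn.comp₁ (R : V → Prop) (h : Dfn 𝔇 fun v : Fin 1 → V => R (v 0))
    (f : (Fin n → V) → V) [DfnFun 𝔇 f] : Dfn 𝔇 fun v => R (f v) := by
  have : Dfn 𝔇 fun w : Fin (n + 1) → V => R (w 0) := ⟨𝔇.subst (fun _ => 0) h.out⟩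
  exact Dfn.bind f fun v x => R x

theorem Dfn.comp₂ (R : V → V → Prop) (h : Dfn 𝔇 fun v : Fin 2 → V => R (v 0) (v 1))
    (f g : (Fin n → V) → V) [DfnFun 𝔇 f] [DfnFun 𝔇 g] : Dfn 𝔇 fun v => R (f v) (g v) := by
  have : Dfn 𝔇 fun w : Fin (n + 2) → V => R (w (Fin.succ 0)) (w 0) :=
    ⟨𝔇.subst ![Fin.succ 0, 0] h.out⟩
  have : Dfn 𝔇 fun w : Fin (n + 1) → V => R (w 0) (g fun i => w i.succ) :=
    Dfn.bind (fun w : Fin (n + 1) → V => g fun i => w i.succ) fun w x => R (w 0) x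
  exact Dfn.bind f fun v x => R x (g v)

theorem DfnFun.comp₁ (F : V → V) (h : DfnFun 𝔇 fun v : Fin 1 → V => F (v 0))
    (f : (Fin n → V) → V) [DfnFun 𝔇 f] : DfnFun 𝔇 fun v => F (f v) :=
  ⟨Dfn.comp₂ (fun x y => x = F y) h.out _ fun w => f fun i => w i.succ⟩

theorem Dfn.comp₃ (R : V → V → V → Prop) (h : Dfn 𝔇 fun v : Fin 3 → V => R (v 0) (v 1) (v 2))
    (f₁ f₂ f₃ : (Fin n → V) → V) [DfnFun 𝔇 f₁] [DfnFun 𝔇 f₂] [DfnFun 𝔇 f₃] :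
    Dfn 𝔇 fun v => R (f₁ v) (f₂ v) (f₃ v) := by
  have : Dfn 𝔇 fun w : Fin (n + 3) → V => R (w (Fin.succ (Fin.succ 0))) (w (Fin.succ 0)) (w 0) :=
    ⟨𝔇.subst ![Fin.succ (Fin.succ 0), Fin.succ 0, 0] h.out⟩
  have : Dfn 𝔇 fun w : Fin (n + 2) → V => R (w (Fin.succ 0)) (w 0) (f₃ fun i => w i.succ.succ) :=
    Dfn.bind (fun w : Fin (n + 2) → V => f₃ fun i => w i.succ.succ)
      fun w x => R (w (Fin.succ 0)) (w 0) x
  have : Dfn 𝔇 fun w : Fin (n + 1) → V => R (w 0) (f₂ fun i => w i.succ) (f₃ fun i => w i.succ) :=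
    Dfn.bind (fun w : Fin (n + 1) → V => f₂ fun i => w i.succ)
      fun w x => R (w 0) x (f₃ fun i => w i.succ)
  exact Dfn.bind f₁ fun v x => R x (f₂ v) (f₃ v)

theorem DfnFun.comp₂ (F : V → V → V) (h : DfnFun 𝔇 fun v : Fin 2 → V => F (v 0) (v 1))
    (f g : (Fin n → V) → V) [DfnFun 𝔇 f] [DfnFun 𝔇 g] : DfnFun 𝔇 fun v => F (f v) (g v) :=
  ⟨Dfn.comp₃ (fun x y z => x = F y z) h.out _ (fun w => f fun i => w i.succ)
    fun w => g fun i => w i.succ⟩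

/-- The binary function `F` is definable. -/
class DfnFun₂ (𝔇 : DefSys E) (F : V → V → V) : Prop where
  out : DfnFun 𝔇 fun v : Fin 2 → V => F (v 0) (v 1)

instance (priority := 20) DfnFun₂.dfnFun (F : V → V → V) [h : DfnFun₂ 𝔇 F]
    (f g : (Fin n → V) → V) [DfnFun 𝔇 f] [DfnFun 𝔇 g] : DfnFun 𝔇 fun v => F (f v) (g v) :=
  DfnFun.comp₂ F h.out f g

/-- The relations on a class `M` that belong to `𝔇` as relations on `V`. -/
def DefSys.rel (𝔇 : DefSys E) (hM : Dfn 𝔇 fun v : Fin 1 → V => v 0 ∈ M) :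
    DefSys (restrict E M) :=
  have hM' : ∀ {n : ℕ}, Dfn 𝔇 fun v : Fin n → V => ∀ i, v i ∈ M := fun {n} => by
    have (i : Fin n) : Dfn 𝔇 fun v : Fin n → V => v i ∈ M := Dfn.comp₁ (· ∈ M) hM _
    exact Dfn.congr (P := fun v => ¬ ∃ i, ¬ v i ∈ M) inferInstance fun v => by simp
  -- The code of a relation on `M` includes the clause that all arguments lie in `M`; each
  -- operation, negation above all, has to restore it.
  { Def := fun {n} P => 𝔇.Def fun v : Fin n → V => ∃ h : ∀ i, v i ∈ M, P fun i => ⟨v i, h i⟩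
    mem := fun {n} i j => (Dfn.congr (P := fun v : Fin n → V => (∀ i, v i ∈ M) ∧ E (v i) (v j))
      inferInstance fun v => by simp [restrict]).out
    eq := fun {n} i j => (Dfn.congr (P := fun v : Fin n → V => (∀ i, v i ∈ M) ∧ v i = v j)
      inferInstance fun v => by simp).out
    not := fun {n P} h => by
      have := Dfn.mk h
      exact (Dfn.congr (P := fun v : Fin n → V => (∀ i, v i ∈ M) ∧
        ¬ ∃ h : ∀ i, v i ∈ M, P fun i => ⟨v i, h i⟩) inferInstance fun v => by
          by_cases h : ∀ i, v i ∈ M <;> simp [h]).out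
    and := fun {n P Q} h h' => by
      have := Dfn.mk h
      have := Dfn.mk h'
      exact (Dfn.congr (P := fun v : Fin n → V => (∃ h : ∀ i, v i ∈ M, P fun i => ⟨v i, h i⟩) ∧
        ∃ h : ∀ i, v i ∈ M, Q fun i => ⟨v i, h i⟩) inferInstance fun v => by
          by_cases h : ∀ i, v i ∈ M <;> simp [h]).out
    ex := fun {n P} h => by
      have := Dfn.congr (Dfn.mk h) (Q := fun w : Fin (n + 1) → V => ∃ h0 : w 0 ∈ M,
        ∃ h : ∀ i : Fin n, w i.succ ∈ M, P (fun i => ⟨w i.succ, h i⟩) ⟨w 0, h0⟩) fun w =>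
          ⟨fun ⟨h0, h, h'⟩ => ⟨Fin.cases h0 h, h'⟩, fun ⟨h, h'⟩ => ⟨h 0, fun i => h i.succ, h'⟩⟩
      exact (Dfn.congr (P := fun v : Fin n → V => ∃ x, ∃ h0 : x ∈ M, ∃ h : ∀ i, v i ∈ M,
        P (fun i => ⟨v i, h i⟩) ⟨x, h0⟩) ⟨𝔇.ex this.out⟩ fun v =>
          ⟨fun ⟨h, ⟨x, h0⟩, h'⟩ => ⟨x, h0, h, h'⟩, fun ⟨x, h0, h, h'⟩ => ⟨h, ⟨x, h0⟩, h'⟩⟩).out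
    subst := fun {n m} σ P h => by
      have := Dfn.mk (𝔇.subst σ h)
      exact (Dfn.congr (P := fun v : Fin m → V => (∀ i, v i ∈ M) ∧
        ∃ h : ∀ i, v (σ i) ∈ M, P fun i => ⟨v (σ i), h i⟩) inferInstance fun v =>
          ⟨fun ⟨h, h'⟩ => ⟨h, fun i => h _, h'⟩, fun ⟨h, _, h'⟩ => ⟨h, h'⟩⟩).out }

theorem dfn_realize {α : Type*} (v : α → V) (φ : langMem.BoundedFormula α n) :
    letI := memStructure E
    Dfn (fullSys E) fun xs => φ.Realize v xs := by
  let := memStructure E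
  refine ⟨show (univ : Set V).Definable langMem _ from definable_iff_exists_formula_sum.2
    ⟨φ.toFormula.relabel (Sum.map (fun a => ⟨v a, mem_univ _⟩) id), ?_⟩⟩
  ext xs
  simp only [mem_ofPred_eq, Formula.realize_relabel, BoundedFormula.realize_toFormula]
  rfl

end Systems

end Definability

/-! ### Elementary set theory inside a model of ZF. -/

section Sets

variable {V : Type*} {E : V → V → Prop} {n : ℕ} {𝔇 : DefSys E}

/-- The family `𝔇` contains all constants, and replacement holds for the relations in `𝔇`. -/
class Replacement (𝔇 : DefSys E) : Prop where
  const : ∀ (n : ℕ) (a : V), DfnFun 𝔇 fun _ : Fin n → V => a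
  out : ∀ R : V → V → Prop, Dfn 𝔇 (fun v : Fin 2 → V => R (v 0) (v 1)) →
    ∀ a, (∀ x, E x a → ∀ y y', R x y → R x y' → y = y') →
      ∃ b, ∀ y, E y b ↔ ∃ x, E x a ∧ R x y

instance Replacement.dfnFun_const [h : Replacement 𝔇] (a : V) : DfnFun 𝔇 fun _ : Fin n → V => a :=
  h.const n a

/-- `(V, E)` is a model of `ZF`. -/
class ZF (E : V → V → Prop) : Prop where
  out : SatisfiesZF E

theorem predSys_replacement {M : Set V} (hM : IsInnerModel E M) : Replacement (predSys E M) where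
  const _ _ := inferInstance
  out R hR a ha :=
    let := memPredStructure E M
    hM.isClass.replacement {p | R p.1 p.2} hR.out a ha

instance fullSys_replacement [h : ZF E] : Replacement (fullSys E) where
  const _ _ := inferInstance
  out R hR a ha :=
    let := memStructure E
    SatisfiesZFIn.replacement h.out {p | R p.1 p.2} hR.out a ha

variable (E) in
/-- The class `Φ` is a set. -/
def IsSet (Φ : V → Prop) : Prop := ∃ y, ∀ z, E z y ↔ Φ z

theorem isSet_mem (x : V) : IsSet E fun z => E z x := ⟨x, fun _ => Iff.rfl⟩

theorem isSet_false [h : ZF E] : IsSet E fun _ => False := by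
  let := memStructure E
  obtain ⟨w, ⟨e, -, he⟩, -⟩ := SatisfiesZFIn.infinity h.out
  exact ⟨e, fun z => by simp [he]⟩

open Classical in
variable (E) in
/-- The set of all `z` with `Φ z`, provided that this class is a set. -/
noncomputable def cls [ZF E] (Φ : V → Prop) : V :=
  if h : IsSet E Φ then h.choose else (isSet_false (E := E)).choose

variable [ZF E]

theorem ext_mem {x y : V} (h : ∀ z, E z x ↔ E z y) : x = y := by
  let := memStructure E
  exact SatisfiesZFIn.extensionality ZF.out x y h

theorem mem_cls {Φ : V → Prop} (h : IsSet E Φ) {z : V} : E z (cls E Φ) ↔ Φ z := by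
  rw [cls, dif_pos h]; exact h.choose_spec z

/-- The default value makes the graph of `cls` first-order in `Φ` even when `Φ` is not a set.
Definability of the later operations thus needs no proof that they yield sets. -/
theorem eq_cls_iff {Φ : V → Prop} {x : V} : x = cls E Φ ↔
    (∀ z, E z x ↔ Φ z) ∨ ((¬ ∃ y, ∀ z, E z y ↔ Φ z) ∧ ∀ z, ¬ E z x) := by
  by_cases h : IsSet E Φ
  · have h' : ∃ y, ∀ z, E z y ↔ Φ z := h
    simp only [h', not_true, false_and, or_false]
    exact ⟨by rintro rfl z; exact mem_cls h, fun h'' => ext_mem fun z => (h'' z).trans (mem_cls h).symm⟩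
  · have h1 : ¬ ∃ y, ∀ z, E z y ↔ Φ z := h
    have h2 : ¬ ∀ z, E z x ↔ Φ z := fun h' => h ⟨x, h'⟩
    simp only [h1, h2, false_or, not_false_eq_true, true_and]
    rw [cls, dif_neg h]
    have := (isSet_false (E := E)).choose_spec
    exact ⟨by rintro rfl z hz; exact (this z).1 hz,
      fun h => ext_mem fun z => ⟨fun hz => (h z hz).elim, fun hz => ((this z).1 hz).elim⟩⟩

instance DfnFun.cls (Φ : (Fin n → V) → V → Prop)
    [h : Dfn 𝔇 (fun w : Fin (n + 1) → V => Φ (fun i => w i.succ) (w 0))] :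
    DfnFun 𝔇 fun v => cls E (Φ v) := by
  refine ⟨Dfn.congr ?_ fun v => eq_cls_iff⟩
  have := DfnFun.mk (𝔇 := 𝔇) (f := fun v : Fin 1 → V => v 0)
  -- In `eq_cls_iff` the bound `z` occurs under `x` alone and under both `x` and `y`, hence the two
  -- shifted copies of `Φ`.
  have : Dfn 𝔇 (fun w : Fin (n + 2) → V => Φ (fun i => w i.succ.succ) (w 0)) :=
    ⟨𝔇.subst (Fin.cons 0 fun i => i.succ.succ) h.out⟩
  have : Dfn 𝔇 (fun w : Fin (n + 3) → V => Φ (fun i => w i.succ.succ.succ) (w 0)) :=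
    ⟨𝔇.subst (Fin.cons 0 fun i => i.succ.succ.succ) h.out⟩
  infer_instance

theorem isSet_sep (x : V) (Φ : V → Prop) [h : Dfn (fullSys E) fun v : Fin 1 → V => Φ (v 0)] :
    IsSet E fun z => E z x ∧ Φ z := by
  let := memStructure E
  exact SatisfiesZFIn.separation ZF.out {z | Φ z} h.out x

theorem IsSet.mono {Φ Ψ : V → Prop} (hΨ : IsSet E Ψ)
    [h : Dfn (fullSys E) fun v : Fin 1 → V => Φ (v 0)] (h' : ∀ z, Φ z → Ψ z) : IsSet E Φ := by
  obtain ⟨x, hx⟩ := hΨ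
  obtain ⟨y, hy⟩ := isSet_sep (E := E) x Φ
  exact ⟨y, fun z => (hy z).trans ⟨And.right, fun h => ⟨(hx z).2 (h' z h), h⟩⟩⟩

theorem isSet_image (x : V) (f : V → V) [DfnFun (fullSys E) fun v : Fin 1 → V => f (v 0)] :
    IsSet E fun z => ∃ y, E y x ∧ z = f y := by
  have : Dfn (fullSys E) fun v : Fin 2 → V => v 1 = f (v 0) :=
    ⟨(fullSys E).subst ![1, 0] (DfnFun.out (f := fun v : Fin 1 → V => f (v 0))).out⟩
  obtain ⟨b, hb⟩ := (fullSys_replacement (E := E)).out (fun y z => z = f y) this x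
    (fun _ _ _ _ h h' => h.trans h'.symm)
  exact ⟨b, hb⟩

variable (E)

/-- The empty set. -/
noncomputable def emp : V := cls E fun _ => False

/-- The pair `{a, b}`. -/
noncomputable def upair (a b : V) : V := cls E fun z => z = a ∨ z = b

/-- The ordered pair. -/
noncomputable def opair (a b : V) : V := upair E (upair E a a) (upair E a b)

/-- The union of the elements of `x`. -/
noncomputable def sUnion (x : V) : V := cls E fun z => ∃ y, E y x ∧ E z y

/-- The union of `x` and `y`. -/
noncomputable def bUnion (x y : V) : V := cls E fun z => E z x ∨ E z y

/-- The power set. -/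
noncomputable def pow (x : V) : V := cls E fun z => ∀ y, E y z → E y x

/-- The successor `x ∪ {x}`. -/
noncomputable def succ (x : V) : V := cls E fun z => E z x ∨ z = x

variable {E}

theorem not_mem_emp (z : V) : ¬ E z (emp E) := fun h => (mem_cls isSet_false).1 h

theorem mem_upair {a b z : V} : E z (upair E a b) ↔ z = a ∨ z = b :=
  mem_cls (let := memStructure E; SatisfiesZFIn.pairing ZF.out a b)

theorem mem_sUnion {x z : V} : E z (sUnion E x) ↔ ∃ y, E y x ∧ E z y :=
  mem_cls (let := memStructure E; SatisfiesZFIn.union ZF.out x)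

theorem mem_pow {x z : V} : E z (pow E x) ↔ ∀ y, E y z → E y x :=
  mem_cls (let := memStructure E; SatisfiesZFIn.powerset ZF.out x)

theorem mem_bUnion {x y z : V} : E z (bUnion E x y) ↔ E z x ∨ E z y :=
  mem_cls ⟨sUnion E (upair E x y), fun z => by simp [mem_sUnion, mem_upair]⟩

theorem mem_succ {x z : V} : E z (succ E x) ↔ E z x ∨ z = x :=
  mem_cls ⟨bUnion E x (upair E x x), fun z => by simp [mem_bUnion, mem_upair]⟩

theorem isPair_iff {p a b : V} : IsPair E p a b ↔ p = upair E a b :=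
  ⟨fun h => ext_mem fun z => (h z).trans mem_upair.symm, by rintro rfl z; exact mem_upair⟩

theorem isOrderedPair_iff {p a b : V} : IsOrderedPair E p a b ↔ p = opair E a b := by
  simp [IsOrderedPair, isPair_iff, opair]

theorem upair_inj {a b c d : V} (h : upair E a b = upair E c d) :
    a = c ∧ b = d ∨ a = d ∧ b = c := by
  have h1 : ∀ z, z = a ∨ z = b ↔ z = c ∨ z = d := fun z => by
    rw [← mem_upair (E := E), h, mem_upair (E := E)]
  have ha := (h1 a).1 (.inl rfl)
  have hb := (h1 b).1 (.inr rfl)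
  have hc := (h1 c).2 (.inl rfl)
  have hd := (h1 d).2 (.inr rfl)
  grind

theorem opair_inj {a b c d : V} : opair E a b = opair E c d ↔ a = c ∧ b = d := by
  refine ⟨fun h => ?_, by rintro ⟨rfl, rfl⟩; rfl⟩
  rcases upair_inj h with ⟨h1, h2⟩ | ⟨h1, h2⟩ <;>
    have h1 := upair_inj h1 <;> have h2 := upair_inj h2 <;> grind

instance DfnFun.emp : DfnFun 𝔇 fun _ : Fin n → V => emp E := by unfold SetModel.emp; infer_instance

variable (f g : (Fin n → V) → V) [DfnFun 𝔇 f] [DfnFun 𝔇 g]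

instance DfnFun.upair : DfnFun 𝔇 fun v => upair E (f v) (g v) := by
  unfold SetModel.upair; infer_instance

instance DfnFun.opair : DfnFun 𝔇 fun v => opair E (f v) (g v) := by
  unfold SetModel.opair; infer_instance

instance DfnFun.sUnion : DfnFun 𝔇 fun v => sUnion E (f v) := by
  unfold SetModel.sUnion; infer_instance

instance DfnFun.succ : DfnFun 𝔇 fun v => succ E (f v) := by
  unfold SetModel.succ; infer_instance

theorem exists_minimal {x : V} (h : ∃ y, E y x) : ∃ y, E y x ∧ ∀ z, E z y → ¬ E z x := by
  let := memStructure E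
  exact SatisfiesZFIn.foundation ZF.out x h

theorem mem_irrefl (x : V) : ¬ E x x := fun h => by
  obtain ⟨y, hy, h'⟩ := exists_minimal (E := E) (x := upair E x x) ⟨x, mem_upair.2 (.inl rfl)⟩
  obtain rfl : y = x := by simpa [mem_upair] using hy
  exact h' y h hy

end Sets

/-! ### Ordinals: induction, comparison, boundedness, collection. -/

section Ordinals

variable {V : Type*} {E : V → V → Prop} {n : ℕ} {𝔇 : DefSys E}

/-- Replacement for the identity restricted to `Φ`. The general `𝔇` is there for relations that
mention a predicate for an inner model. -/
theorem isSet_sep' (𝔇 : DefSys E) [Replacement 𝔇] (x : V) (Φ : V → Prop)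
    [Dfn 𝔇 fun v : Fin 1 → V => Φ (v 0)] : IsSet E fun z => E z x ∧ Φ z := by
  have : Dfn 𝔇 fun v : Fin 2 → V => Φ (v 0) := Dfn.comp₁ Φ inferInstance _
  obtain ⟨b, hb⟩ := Replacement.out (𝔇 := 𝔇) (fun y z => y = z ∧ Φ y) inferInstance x
    (by rintro _ _ _ _ ⟨rfl, _⟩ ⟨rfl, _⟩; rfl)
  exact ⟨b, fun z => (hb z).trans
    ⟨by rintro ⟨y, hy, rfl, h⟩; exact ⟨hy, h⟩, fun ⟨h, h'⟩ => ⟨z, h, rfl, h'⟩⟩⟩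

theorem IsOrd.mem {a x : V} (ha : IsOrd E a) (h : E x a) : IsOrd E x :=
  ⟨ha.2 x h, fun y hy => ha.2 y (ha.1 x h y hy)⟩

theorem IsOrd.trans {a x y : V} (ha : IsOrd E a) (h : E x a) (h' : E y x) : E y a := ha.1 x h y h'

theorem isOrd_of_trans {a : V} (h : IsTransSet E a) (h' : ∀ x, E x a → IsOrd E x) : IsOrd E a :=
  ⟨h, fun x hx => (h' x hx).1⟩

variable [ZF E]

variable (E) in
/-- `a` is the least ordinal in the class `P`. -/
def IsLeastOrd (P : V → Prop) (a : V) : Prop := IsOrd E a ∧ P a ∧ ∀ b, E b a → ¬ P b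

instance Dfn.isLeastOrd (P : (Fin n → V) → V → Prop) (f : (Fin n → V) → V) [DfnFun 𝔇 f]
    [Dfn 𝔇 fun w : Fin (n + 1) → V => P (fun i => w i.succ) (w 0)] :
    Dfn 𝔇 fun v => IsLeastOrd E (P v) (f v) := by
  have := Dfn.bind f P (𝔇 := 𝔇)
  unfold IsLeastOrd; infer_instance

theorem exists_isLeastOrd (𝔇 : DefSys E) [Replacement 𝔇] (P : V → Prop)
    [Dfn 𝔇 fun v : Fin 1 → V => P (v 0)] {a : V} (ha : IsOrd E a) (h : P a) :
    ∃ b, IsLeastOrd E P b := by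
  by_cases h' : ∃ x, E x a ∧ P x
  · obtain ⟨c, hc⟩ := isSet_sep' 𝔇 a P
    obtain ⟨y, hy, hy'⟩ := exists_minimal (E := E) (x := c) (by simpa [hc] using h')
    have hy := (hc y).1 hy
    exact ⟨y, ha.mem hy.1, hy.2, fun b hb hP => hy' b hb ((hc b).2 ⟨ha.trans hy.1 hb, hP⟩)⟩
  · exact ⟨a, ha, h, fun b hb hP => h' ⟨b, hb, hP⟩⟩

theorem ord_induction (P : V → Prop) [Dfn (fullSys E) fun v : Fin 1 → V => P (v 0)]
    (h : ∀ a, IsOrd E a → (∀ b, E b a → P b) → P a) {a : V} (ha : IsOrd E a) : P a := by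
  by_contra hP
  obtain ⟨b, hb, hb', hb''⟩ := exists_isLeastOrd (fullSys E) (fun x => ¬ P x) ha hP
  exact hb' (h b hb fun c hc => by_contra (hb'' c hc))

theorem IsOrd.trichotomy {a b : V} (ha : IsOrd E a) (hb : IsOrd E b) : E a b ∨ a = b ∨ E b a := by
  refine ord_induction (fun a => ∀ b, IsOrd E b → E a b ∨ a = b ∨ E b a) ?_ ha b hb
  intro a ha iha b hb
  refine ord_induction (fun b => E a b ∨ a = b ∨ E b a) ?_ hb
  intro b hb ihb
  by_cases h1 : ∃ y, E y b ∧ (E a y ∨ a = y)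
  · obtain ⟨y, hy, h | rfl⟩ := h1
    · exact .inl (hb.trans hy h)
    · exact .inl hy
  by_cases h2 : ∃ x, E x a ∧ (E b x ∨ b = x)
  · obtain ⟨x, hx, h | rfl⟩ := h2
    · exact .inr (.inr (ha.trans hx h))
    · exact .inr (.inr hx)
  refine .inr (.inl (ext_mem (E := E) fun z => ⟨fun hz => ?_, fun hz => ?_⟩))
  · have := iha z hz b hb
    grind
  · have := ihb z hz
    grind

theorem IsLeastOrd.unique {P : V → Prop} {a b : V} (ha : IsLeastOrd E P a)
    (hb : IsLeastOrd E P b) : a = b := by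
  rcases ha.1.trichotomy hb.1 with h | h | h
  · exact (hb.2.2 a h ha.2.1).elim
  · exact h
  · exact (ha.2.2 b h hb.2.1).elim

theorem isOrd_emp : IsOrd E (emp E) :=
  ⟨fun x hx => (not_mem_emp x hx).elim, fun x hx => (not_mem_emp x hx).elim⟩

theorem IsOrd.succ {a : V} (ha : IsOrd E a) : IsOrd E (succ E a) := by
  refine isOrd_of_trans (fun x hx y hy => mem_succ.2 (.inl ?_)) fun x hx => ?_ <;>
    rcases mem_succ.1 hx with hx | rfl
  exacts [ha.trans hx hy, hy, ha.mem hx, ha]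

theorem mem_succ_self (a : V) : E a (succ E a) := mem_succ.2 (.inr rfl)

/-- Every set of ordinals is bounded. -/
theorem exists_ord_bound (x : V) : ∃ l, IsOrd E l ∧ ∀ a, IsOrd E a → E a x → E a l := by
  obtain ⟨y, hy⟩ := isSet_sep (E := E) x (IsOrd E)
  have hU : IsOrd E (sUnion E y) := by
    refine isOrd_of_trans (fun z hz u hu => ?_) fun z hz => ?_ <;>
      obtain ⟨w, hw, hz⟩ := mem_sUnion.1 hz <;> have hw' := ((hy w).1 hw).2
    exacts [mem_sUnion.2 ⟨w, hw, hw'.trans hz hu⟩, hw'.mem hz]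
  refine ⟨_, hU.succ, fun a ha hax => mem_succ.2 ?_⟩
  rcases ha.trichotomy hU with h | h | h
  · exact .inl h
  · exact .inr h
  · exact (mem_irrefl _ (mem_sUnion.2 ⟨a, (hy a).2 ⟨hax, ha⟩, h⟩)).elim

theorem not_isSet_ordinals (x : V) : ¬ ∀ a, IsOrd E a → E a x := fun h => by
  obtain ⟨l, hl, h'⟩ := exists_ord_bound (E := E) x
  exact mem_irrefl l (h' l hl (h l hl))

/-- Taking the least witness makes the relation single-valued without choice; replacement then
collects the witnesses into a set, which is bounded. -/
theorem collection (𝔇 : DefSys E) [Replacement 𝔇] (R : V → V → Prop)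
    [Dfn 𝔇 fun v : Fin 2 → V => R (v 0) (v 1)] (x : V)
    (h : ∀ y, E y x → ∃ a, IsOrd E a ∧ R y a) :
    ∃ l, IsOrd E l ∧ ∀ y, E y x → ∃ a, E a l ∧ R y a := by
  have h2 {n : ℕ} (f g : (Fin n → V) → V) [DfnFun 𝔇 f] [DfnFun 𝔇 g] :
      Dfn 𝔇 fun v => R (f v) (g v) := Dfn.comp₂ R inferInstance f g
  obtain ⟨b, hb⟩ := Replacement.out (𝔇 := 𝔇) (fun y a => IsLeastOrd E (R y) a)
    inferInstance x fun y _ _ _ h h' => h.unique h'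
  obtain ⟨l, hl, hl'⟩ := exists_ord_bound (E := E) b
  refine ⟨l, hl, fun y hy => ?_⟩
  obtain ⟨a, ha, hR⟩ := h y hy
  obtain ⟨c, hc⟩ := exists_isLeastOrd 𝔇 (R y) ha hR
  exact ⟨c, hl' c hc.1 ((hb c).2 ⟨y, hy, hc⟩), hc.2.1⟩

/-- No definable function on a final segment of the ordinals is one-to-one with values in a set. -/
theorem not_injOn_ordinals (f : V → V) [DfnFun (fullSys E) fun v : Fin 1 → V => f (v 0)] {m : V}
    (hm : IsOrd E m) (x : V) (h : ∀ a, IsOrd E a → E m a → E (f a) x)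
    (hf : ∀ a b, IsOrd E a → E m a → E a b → IsOrd E b → f a ≠ f b) : False := by
  have h1 {n : ℕ} (g : (Fin n → V) → V) [DfnFun (fullSys E) g] :
      DfnFun (fullSys E) fun v => f (g v) := DfnFun.comp₁ f inferInstance g
  -- Replacement for the inverse of `f` would make the ordinals above `m` a set.
  obtain ⟨b, hb⟩ := Replacement.out (𝔇 := fullSys E) (fun y a => IsOrd E a ∧ E m a ∧ y = f a)
    inferInstance x (by
      rintro y _ a a' ⟨ha, hma, rfl⟩ ⟨ha', hma', h⟩
      rcases ha.trichotomy ha' with h' | h' | h'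
      · exact (hf a a' ha hma h' ha' h).elim
      · exact h'
      · exact (hf a' a ha' hma' h' ha h.symm).elim)
  refine not_isSet_ordinals (E := E) (bUnion E b (succ E m)) fun a ha => mem_bUnion.2 ?_
  rcases ha.trichotomy hm with h' | rfl | h'
  · exact .inr (mem_succ.2 (.inl h'))
  · exact .inr (mem_succ_self _)
  · exact .inl ((hb a).2 ⟨f a, h a ha h', ha, h', rfl⟩)

variable (E) in
theorem exists_limit : ∃ l, IsOrd E l ∧ E (emp E) l ∧ ∀ x, E x l → E (succ E x) l := by
  let := memStructure E
  obtain ⟨w, ⟨e, hew, he⟩, hw⟩ := SatisfiesZFIn.infinity (V := V) (E := E) ZF.out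
  -- An inductive set need not be transitive; keeping only the ordinals that are also subsets of `w`
  -- repairs this.
  obtain ⟨l, hl⟩ := isSet_sep (E := E) w fun x => IsOrd E x ∧ ∀ y, E y x → E y w
  refine ⟨l, isOrd_of_trans (fun x hx y hy => ?_) (fun x hx => ((hl x).1 hx).2.1), ?_, ?_⟩
  · have hx := (hl x).1 hx
    exact (hl y).2 ⟨hx.2.2 y hy, hx.2.1.mem hy, fun z hz => hx.2.2 z (hx.2.1.trans hy hz)⟩
  · have : e = emp E := ext_mem (E := E) fun z => ⟨fun h => (he z h).elim, fun h => (not_mem_emp z h).elim⟩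
    exact (hl _).2 ⟨this ▸ hew, isOrd_emp, fun y hy => (not_mem_emp y hy).elim⟩
  · intro x hx
    have hx := (hl x).1 hx
    obtain ⟨s, hs, hs'⟩ := hw x hx.1
    have : s = succ E x := ext_mem (E := E) fun z => (hs' z).trans mem_succ.symm
    refine (hl _).2 ⟨this ▸ hs, hx.2.1.succ, fun y hy => ?_⟩
    rcases mem_succ.1 hy with hy | rfl
    exacts [hx.2.2 y hy, hx.1]

end Ordinals

/-! ### Recursion along the ordinals with a parameter. -/

section Recursion

variable {V : Type*} {E : V → V → Prop} {n : ℕ} [ZF E]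

variable (E) in
/-- The restriction of the function `g` to the set `a`. -/
noncomputable def restr (g a : V) : V := cls E fun q => E q g ∧ ∃ x y, E x a ∧ q = opair E x y

theorem mem_restr {g a q : V} : E q (restr E g a) ↔ E q g ∧ ∃ x y, E x a ∧ q = opair E x y :=
  mem_cls (isSet_sep g _)

variable (E) (N : V → V → V)

/-- `g` is a function on `a` that satisfies the recursion equation given by `N`. -/
def Attempt (p a g : V) : Prop :=
  ∀ q, E q g ↔ ∃ x, E x a ∧ q = opair E x (N p (restr E g x))

/-- The function on the ordinal `a` that is defined by recursion from `N`. -/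
noncomputable def hist (p a : V) : V := cls E fun q => ∃ g, Attempt E N p a g ∧ E q g

/-- The value at the ordinal `a` of the function that is defined by recursion from `N`. -/
noncomputable def ordRec (p a : V) : V := N p (hist E N p a)

section

variable {E} {𝔇 : DefSys E} (f g : (Fin n → V) → V) [DfnFun 𝔇 f] [DfnFun 𝔇 g]

instance DfnFun.restr : DfnFun 𝔇 fun v => restr E (f v) (g v) := by
  unfold SetModel.restr; infer_instance

variable [DfnFun₂ 𝔇 N]

instance Dfn.attempt (h : (Fin n → V) → V) [DfnFun 𝔇 h] :
    Dfn 𝔇 fun v => Attempt E N (f v) (g v) (h v) := by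
  unfold Attempt; infer_instance

instance DfnFun.hist : DfnFun 𝔇 fun v => hist E N (f v) (g v) := by
  unfold SetModel.hist; infer_instance

instance DfnFun.ordRec : DfnFun 𝔇 fun v => ordRec E N (f v) (g v) := by
  unfold SetModel.ordRec; infer_instance

end

variable {E N} {p a b g g' : V}

theorem Attempt.mem_restr (hg : Attempt E N p a g) (ha : IsOrd E a) (h : E b a) {q : V} :
    E q (restr E g b) ↔ ∃ x, E x b ∧ q = opair E x (N p (restr E g x)) := by
  rw [SetModel.mem_restr (E := E), hg q]
  constructor
  · rintro ⟨⟨x, hx, rfl⟩, y, z, hy, h'⟩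
    obtain ⟨rfl, h'⟩ := opair_inj.1 h'
    exact ⟨x, hy, rfl⟩
  · rintro ⟨x, hx, rfl⟩
    exact ⟨⟨x, ha.trans h hx, rfl⟩, x, _, hx, rfl⟩

theorem Attempt.restr_eq (hg : Attempt E N p a g) (hg' : Attempt E N p b g') (ha : IsOrd E a)
    (hb : IsOrd E b) {c : V} (hc : IsOrd E c) : E c a → E c b → restr E g c = restr E g' c := by
  refine ord_induction (fun c => E c a → E c b → restr E g c = restr E g' c) ?_ hc
  intro c _ ih hca hcb
  refine ext_mem (E := E) fun q => ?_
  rw [hg.mem_restr ha hca, hg'.mem_restr hb hcb]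
  refine exists_congr fun x => and_congr_right fun hx => ?_
  rw [ih x hx (ha.trans hca hx) (hb.trans hcb hx)]

theorem Attempt.restr (hg : Attempt E N p a g) (ha : IsOrd E a) (h : E b a) :
    Attempt E N p b (restr E g b) := by
  intro q
  rw [hg.mem_restr ha h]
  refine exists_congr fun x => and_congr_right fun hx => ?_
  have : SetModel.restr E (SetModel.restr E g b) x = SetModel.restr E g x := by
    refine ext_mem (E := E) fun r => ?_
    rw [SetModel.mem_restr (E := E), SetModel.mem_restr (E := E), SetModel.mem_restr (E := E)]
    constructor
    · rintro ⟨⟨h, -⟩, h'⟩; exact ⟨h, h'⟩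
    · rintro ⟨h1, y, z, hy, rfl⟩
      exact ⟨⟨h1, y, z, (ha.mem h).trans hx hy, rfl⟩, y, z, hy, rfl⟩
  rw [this]

theorem Attempt.unique (hg : Attempt E N p a g) (hg' : Attempt E N p a g') (ha : IsOrd E a) :
    g = g' := by
  refine ext_mem (E := E) fun q => ?_
  rw [hg q, hg' q]
  refine exists_congr fun x => and_congr_right fun hx => ?_
  rw [hg.restr_eq hg' ha ha (ha.mem hx) hx hx]

theorem Attempt.eq_hist (hg : Attempt E N p a g) (ha : IsOrd E a) : hist E N p a = g := by
  have (q : V) : (∃ g, Attempt E N p a g ∧ E q g) ↔ E q g :=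
    ⟨fun ⟨g', h, h'⟩ => hg.unique h ha ▸ h', fun h => ⟨g, hg, h⟩⟩
  refine ext_mem (E := E) fun q => ?_
  rw [hist, mem_cls (E := E) ⟨g, fun q => (this q).symm⟩, this]

variable [DfnFun₂ (fullSys E) N]

/-- Attempts are unique and cohere under restriction, so only existence is left. By induction,
`ordRec` has the right values below `a`, and replacement turns its graph on `a` into a set. -/
theorem attempt_hist (p : V) (ha : IsOrd E a) : Attempt E N p a (hist E N p a) := by
  suffices h : ∃ g, Attempt E N p a g by
    obtain ⟨g, hg⟩ := h
    rwa [hg.eq_hist ha]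
  refine ord_induction (fun a => ∃ g, Attempt E N p a g) ?_ ha
  intro a ha ih
  obtain ⟨g, hg⟩ := isSet_image (E := E) a fun x => opair E x (ordRec E N p x)
  refine ⟨g, fun q => ?_⟩
  rw [hg]
  refine exists_congr fun x => and_congr_right fun hx => ?_
  have : SetModel.restr E g x = hist E N p x := by
    obtain ⟨h, hh⟩ := ih x hx
    rw [hh.eq_hist (ha.mem hx)]
    refine ext_mem (E := E) fun q => ?_
    rw [hh q, SetModel.mem_restr (E := E), hg]
    constructor
    · rintro ⟨⟨y, hy, rfl⟩, z, w, hz, h'⟩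
      obtain ⟨rfl, -⟩ := opair_inj.1 h'
      exact ⟨y, hz, by rw [ordRec, (hh.restr (ha.mem hx) hz).eq_hist ((ha.mem hx).mem hz)]⟩
    · rintro ⟨y, hy, rfl⟩
      rw [← (hh.restr (ha.mem hx) hy).eq_hist ((ha.mem hx).mem hy)]
      exact ⟨⟨y, ha.trans hx hy, rfl⟩, y, _, hy, rfl⟩
  rw [this, ordRec]

theorem mem_hist (ha : IsOrd E a) {q : V} :
    E q (hist E N p a) ↔ ∃ x, E x a ∧ q = opair E x (ordRec E N p x) := by
  have h := attempt_hist (N := N) p ha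
  rw [h q]
  refine exists_congr fun x => and_congr_right fun hx => ?_
  rw [ordRec, (h.restr ha hx).eq_hist (ha.mem hx)]

theorem opair_mem_hist (ha : IsOrd E a) {x y : V} :
    E (opair E x y) (hist E N p a) ↔ E x a ∧ y = ordRec E N p x := by
  rw [mem_hist ha]
  constructor
  · rintro ⟨z, hz, h⟩
    obtain ⟨rfl, rfl⟩ := opair_inj.1 h
    exact ⟨hz, rfl⟩
  · rintro ⟨h, rfl⟩
    exact ⟨x, h, rfl⟩

end Recursion

/-! ### Transitive closures and the cumulative hierarchy. -/

section Hierarchy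

variable {V : Type*} {E : V → V → Prop} {n : ℕ} {𝔇 : DefSys E} [ZF E]

theorem mem_sUnion_sUnion_of_opair {x y g : V} (h : E (opair E x y) g) :
    E x (sUnion E (sUnion E g)) ∧ E y (sUnion E (sUnion E g)) :=
  have h' : E (upair E x y) (sUnion E g) := mem_sUnion.2 ⟨_, h, mem_upair.2 (.inr rfl)⟩
  ⟨mem_sUnion.2 ⟨_, h', mem_upair.2 (.inl rfl)⟩, mem_sUnion.2 ⟨_, h', mem_upair.2 (.inr rfl)⟩⟩

variable (E)

/-- The recursion step of the transitive closure. -/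
noncomputable def tcStep (p g : V) : V :=
  cls E fun z => E z p ∨ ∃ x b y, E (opair E x b) g ∧ E y b ∧ E z y

/-- The recursion step of the cumulative hierarchy. -/
noncomputable def hierStep (_ g : V) : V :=
  cls E fun y => ∃ x b, E (opair E x b) g ∧ ∀ z, E z y → E z b

/-- The levels of the cumulative hierarchy. -/
noncomputable def hier (a : V) : V := ordRec E (hierStep E) (emp E) a

/-- The transitive closure of `{a}`. -/
noncomputable def tcl (a : V) : V := cls E fun z => ∀ s, IsTransSet E s → E a s → E z s

instance : DfnFun₂ 𝔇 (tcStep E) := ⟨by unfold tcStep; infer_instance⟩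

instance : DfnFun₂ 𝔇 (hierStep E) := ⟨by unfold hierStep; infer_instance⟩

variable {E}

instance DfnFun.hier (f : (Fin n → V) → V) [DfnFun 𝔇 f] : DfnFun 𝔇 fun v => hier E (f v) := by
  unfold SetModel.hier; infer_instance

instance DfnFun.tcl (f : (Fin n → V) → V) [DfnFun 𝔇 f] : DfnFun 𝔇 fun v => tcl E (f v) := by
  unfold SetModel.tcl; infer_instance

theorem mem_tcStep {p g z : V} :
    E z (tcStep E p g) ↔ E z p ∨ ∃ x b y, E (opair E x b) g ∧ E y b ∧ E z y := by
  refine mem_cls (IsSet.mono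
    (isSet_mem (bUnion E p (sUnion E (sUnion E (sUnion E (sUnion E g)))))) ?_)
  rintro z (h | ⟨x, b, y, h, hy, hz⟩)
  · exact mem_bUnion.2 (.inl h)
  · exact mem_bUnion.2 (.inr (mem_sUnion.2 ⟨y, mem_sUnion.2
      ⟨b, (mem_sUnion_sUnion_of_opair h).2, hy⟩, hz⟩))

theorem mem_hierStep {p g y : V} :
    E y (hierStep E p g) ↔ ∃ x b, E (opair E x b) g ∧ ∀ z, E z y → E z b := by
  refine mem_cls (IsSet.mono (isSet_mem (pow E (sUnion E (sUnion E (sUnion E g))))) ?_)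
  rintro y ⟨x, b, h, hy⟩
  exact mem_pow.2 fun z hz => mem_sUnion.2 ⟨b, (mem_sUnion_sUnion_of_opair h).2, hy z hz⟩

theorem mem_hier {a y : V} (ha : IsOrd E a) :
    E y (hier E a) ↔ ∃ b, E b a ∧ ∀ z, E z y → E z (hier E b) := by
  rw [hier, ordRec, mem_hierStep (E := E)]
  simp only [opair_mem_hist ha]
  exact ⟨fun ⟨b, _, ⟨h, rfl⟩, h'⟩ => ⟨b, h, h'⟩, fun ⟨b, h, h'⟩ => ⟨b, _, ⟨h, rfl⟩, h'⟩⟩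

/-- Stage `b` of the recursion consists of the elements of `a` and the elements of elements of
earlier stages. At a limit this is transitive, because what enters through stage `c` has its
elements in through stage `succ c`; finally `a` itself is added. -/
theorem exists_transSet (a : V) : ∃ t, IsTransSet E t ∧ E a t := by
  obtain ⟨l, hl, h0, hs⟩ := exists_limit E
  have key {b z : V} (hb : IsOrd E b) : E z (ordRec E (tcStep E) a b) ↔
      E z a ∨ ∃ c y, E c b ∧ E y (ordRec E (tcStep E) a c) ∧ E z y := by
    rw [ordRec, mem_tcStep (E := E)]
    simp only [opair_mem_hist hb]
    refine or_congr_right ⟨fun ⟨c, _, y, ⟨h, rfl⟩, h'⟩ => ⟨c, y, h, h'⟩,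
      fun ⟨c, y, h, h'⟩ => ⟨c, _, y, ⟨h, rfl⟩, h'⟩⟩
  refine ⟨bUnion E (ordRec E (tcStep E) a l) (upair E a a), fun z hz u hu => ?_,
    mem_bUnion.2 (.inr (mem_upair.2 (.inl rfl)))⟩
  refine mem_bUnion.2 (.inl ((key hl).2 ?_))
  rcases mem_bUnion.1 hz with hz | hz
  · rcases (key hl).1 hz with hz | ⟨c, y, hc, hy, hz⟩
    · exact .inr ⟨_, z, h0, (key (hl.mem h0)).2 (.inl hz), hu⟩
    · exact .inr ⟨_, z, hs c hc, (key (hl.mem hc).succ).2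
        (.inr ⟨c, y, mem_succ_self c, hy, hz⟩), hu⟩
  · obtain rfl : z = a := by simpa using mem_upair.1 hz
    exact .inl hu

theorem mem_tcl {a z : V} :
    E z (tcl E a) ↔ ∀ s, IsTransSet E s → E a s → E z s := by
  obtain ⟨t, ht, hat⟩ := exists_transSet (E := E) a
  exact mem_cls (IsSet.mono (isSet_mem t) fun z hz => hz t ht hat)

theorem isTransSet_tcl (a : V) : IsTransSet E (tcl E a) := fun x hx y hy =>
  mem_tcl.2 fun s hs ha => hs x (mem_tcl.1 hx s hs ha) y hy

theorem mem_tcl_self (a : V) : E a (tcl E a) := mem_tcl.2 fun _ _ h => h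

theorem isTclSingleton_iff {t a : V} : IsTclSingleton E t a ↔ t = tcl E a := by
  constructor
  · intro h
    exact ext_mem (E := E) fun z => ⟨h.2 _ (isTransSet_tcl a) (mem_tcl_self a) z,
      fun hz => mem_tcl.1 hz t h.1.1 h.1.2⟩
  · rintro rfl
    exact ⟨⟨isTransSet_tcl a, mem_tcl_self a⟩, fun s hs ha x hx => mem_tcl.1 hx s hs ha⟩

theorem mem_induction (P : V → Prop) [Dfn (fullSys E) fun v : Fin 1 → V => P (v 0)]
    (h : ∀ a, (∀ b, E b a → P b) → P a) (a : V) : P a := by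
  by_contra hP
  obtain ⟨c, hc⟩ := isSet_sep (E := E) (tcl E a) fun x => ¬ P x
  obtain ⟨y, hy, hy'⟩ := exists_minimal (E := E) ⟨a, (hc a).2 ⟨mem_tcl_self a, hP⟩⟩
  have hy := (hc y).1 hy
  exact hy.2 (h y fun b hb => by_contra fun hb' =>
    hy' b hb ((hc b).2 ⟨isTransSet_tcl a y hy.1 b hb, hb'⟩))

theorem hier_mono {a b y : V} (ha : IsOrd E a) (hb : IsOrd E b) (h : ∀ z, E z a → E z b)
    (hy : E y (hier E a)) : E y (hier E b) := by
  obtain ⟨c, hc, h'⟩ := (mem_hier ha).1 hy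
  exact (mem_hier hb).2 ⟨c, h c hc, h'⟩

theorem hier_mono_mem {a b y : V} (hb : IsOrd E b) (h : E a b)
    (hy : E y (hier E a)) : E y (hier E b) :=
  hier_mono (hb.mem h) hb (fun _ hz => hb.trans h hz) hy

theorem hier_succ {a y : V} (ha : IsOrd E a) (h : ∀ z, E z y → E z (hier E a)) :
    E y (hier E (succ E a)) := (mem_hier ha.succ).2 ⟨a, mem_succ_self a, h⟩

theorem exists_mem_hier (x : V) : ∃ a, IsOrd E a ∧ E x (hier E a) := by
  refine mem_induction (E := E) (fun x => ∃ a, IsOrd E a ∧ E x (hier E a)) ?_ x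
  intro x ih
  obtain ⟨l, hl, h⟩ := collection (fullSys E) (fun y a => E y (hier E a)) x ih
  refine ⟨_, hl.succ, hier_succ hl fun z hz => ?_⟩
  obtain ⟨a, ha, hz⟩ := h z hz
  exact hier_mono_mem hl ha hz

end Hierarchy

/-! ### Listing the closure of the ordinals under a definable operation. -/

section Enumeration

variable {V : Type*} {E : V → V → Prop} {n : ℕ} {𝔇 : DefSys E} [ZF E]

theorem isSet_iUnion (a : V) (F : V → V) [DfnFun (fullSys E) fun v : Fin 1 → V => F (v 0)] :
    IsSet E fun z => ∃ x, E x a ∧ E z (F x) := by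
  obtain ⟨b, hb⟩ := isSet_image (E := E) a F
  refine ⟨sUnion E b, fun z => mem_sUnion.trans ?_⟩
  constructor
  · rintro ⟨y, hy, hz⟩
    obtain ⟨x, hx, rfl⟩ := (hb y).1 hy
    exact ⟨x, hx, hz⟩
  · rintro ⟨x, hx, hz⟩
    exact ⟨F x, (hb _).2 ⟨x, hx, rfl⟩, hz⟩

variable (E)

/-- The value of the function `g` at `x`, and the empty set outside of its domain. -/
noncomputable def app (g x : V) : V := cls E fun z => ∃ b, E (opair E x b) g ∧ E z b

variable (W : V → V → V)

/-- The value that `W` assigns to the tag `t` and to the values of `g` at `a` and `b`. -/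
noncomputable def candidate (p g t a b : V) : V :=
  W p (opair E t (opair E a (opair E (app E g a) (app E g b))))

/-- The candidate given by `t, a, b ≤ m` is not yet a value of `g`. -/
def Fresh (p g m t a b : V) : Prop :=
  E t (succ E m) ∧ E a (succ E m) ∧ E b (succ E m) ∧ ∀ x, ¬ E (opair E x (candidate E W p g t a b)) g

/-- `t, a, b` is the first fresh triple. -/
def FirstFresh (p g m t a b : V) : Prop :=
  IsLeastOrd E (fun m => ∃ t a b, Fresh E W p g m t a b) m ∧
    IsLeastOrd E (fun t => ∃ a b, Fresh E W p g m t a b) t ∧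
    IsLeastOrd E (fun a => ∃ b, Fresh E W p g m t a b) a ∧
    IsLeastOrd E (fun b => Fresh E W p g m t a b) b

/-- The first fresh candidate. -/
noncomputable def enumStep (p g : V) : V :=
  cls E fun z => ∃ m t a b, FirstFresh E W p g m t a b ∧ E z (candidate E W p g t a b)

/-- The enumeration, along the ordinals, of the closure of the class of ordinals under `W`. -/
noncomputable def enum (p a : V) : V := ordRec E (enumStep E W) p a

section

variable {E} (f₁ f₂ f₃ f₄ f₅ f₆ : (Fin n → V) → V) [DfnFun 𝔇 f₁] [DfnFun 𝔇 f₂] [DfnFun 𝔇 f₃]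
  [DfnFun 𝔇 f₄] [DfnFun 𝔇 f₅] [DfnFun 𝔇 f₆]

instance DfnFun.app : DfnFun 𝔇 fun v => app E (f₁ v) (f₂ v) := by
  unfold SetModel.app; infer_instance

variable [DfnFun₂ 𝔇 W]

instance DfnFun.candidate :
    DfnFun 𝔇 fun v => candidate E W (f₁ v) (f₂ v) (f₃ v) (f₄ v) (f₅ v) := by
  unfold SetModel.candidate; infer_instance

instance Dfn.fresh :
    Dfn 𝔇 fun v => Fresh E W (f₁ v) (f₂ v) (f₃ v) (f₄ v) (f₅ v) (f₆ v) := by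
  unfold Fresh; infer_instance

instance Dfn.firstFresh :
    Dfn 𝔇 fun v => FirstFresh E W (f₁ v) (f₂ v) (f₃ v) (f₄ v) (f₅ v) (f₆ v) := by
  unfold FirstFresh; infer_instance

instance : DfnFun₂ 𝔇 (enumStep E W) := ⟨by unfold enumStep; infer_instance⟩

instance DfnFun.enum : DfnFun 𝔇 fun v => enum E W (f₁ v) (f₂ v) := by
  unfold SetModel.enum; infer_instance

end

variable {E W}

theorem app_eq {g x b : V} (h : ∀ c, E (opair E x c) g ↔ c = b) : app E g x = b := by
  have : ∀ z, E z b ↔ ∃ c, E (opair E x c) g ∧ E z c := fun z => by simp [h]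
  exact ext_mem (E := E) fun z => (mem_cls ⟨b, this⟩).trans (this z).symm

theorem FirstFresh.enumStep_eq {p g m t a b : V} (h : FirstFresh E W p g m t a b) :
    enumStep E W p g = candidate E W p g t a b := by
  have : ∀ z, E z (candidate E W p g t a b) ↔
      ∃ m t a b, FirstFresh E W p g m t a b ∧ E z (candidate E W p g t a b) := by
    refine fun z => ⟨fun hz => ⟨m, t, a, b, h, hz⟩, ?_⟩
    rintro ⟨m', t', a', b', h', hz⟩
    obtain rfl := h.1.unique h'.1
    obtain rfl := h.2.1.unique h'.2.1
    obtain rfl := h.2.2.1.unique h'.2.2.1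
    obtain rfl := h.2.2.2.unique h'.2.2.2
    exact hz
  exact ext_mem (E := E) fun z => (mem_cls ⟨_, this⟩).trans (this z).symm

variable [DfnFun₂ (fullSys E) W]

/-- The common bound is minimised before the triple, so the selected triple stays below any bound
that admits a fresh one. This confines the candidates to a set in `exists_enum_eq`. -/
theorem exists_firstFresh {p g m t a b : V} (hm : IsOrd E m) (h : Fresh E W p g m t a b) :
    ∃ m' t' a' b', FirstFresh E W p g m' t' a' b' ∧ E m' (succ E m) := by
  obtain ⟨m', hm'⟩ := exists_isLeastOrd (fullSys E) (fun m => ∃ t a b, Fresh E W p g m t a b) hm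
    ⟨t, a, b, h⟩
  obtain ⟨t, a, b, h'⟩ := hm'.2.1
  have hs := hm'.1.succ
  obtain ⟨t', ht'⟩ := exists_isLeastOrd (fullSys E) (fun t => ∃ a b, Fresh E W p g m' t a b)
    (hs.mem h'.1) ⟨a, b, h'⟩
  obtain ⟨a, b, h'⟩ := ht'.2.1
  obtain ⟨a', ha'⟩ := exists_isLeastOrd (fullSys E) (fun a => ∃ b, Fresh E W p g m' t' a b)
    (hs.mem h'.2.1) ⟨b, h'⟩
  obtain ⟨b, h'⟩ := ha'.2.1
  obtain ⟨b', hb'⟩ := exists_isLeastOrd (fullSys E) (fun b => Fresh E W p g m' t' a' b)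
    (hs.mem h'.2.2.1) h'
  refine ⟨m', t', a', b', ⟨hm', ht', ha', hb'⟩, mem_succ.2 ?_⟩
  rcases hm.trichotomy hm'.1 with h1 | h1 | h1
  · exact (hm'.2.2 m h1 ⟨_, _, _, h⟩).elim
  · exact .inr h1.symm
  · exact .inl h1

theorem app_hist_enum {p x a : V} (hx : IsOrd E x) (ha : E a x) :
    app E (hist E (enumStep E W) p x) a = enum E W p a :=
  app_eq fun c => by simp [opair_mem_hist hx, ha, enum]

/-- The range of the enumeration is closed under `W`. -/
theorem exists_enum_eq (p : V) {t a b : V} (ht : IsOrd E t) (ha : IsOrd E a) (hb : IsOrd E b) :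
    ∃ x, IsOrd E x ∧ enum E W p x =
      W p (opair E t (opair E a (opair E (enum E W p a) (enum E W p b)))) := by
  -- If the value is never listed, the triple stays fresh at every stage beyond a bound `m` of its
  -- entries. Each such stage then lists a new value taken from the set `K` of candidates with
  -- indices at most `m`, which injects a final segment of the ordinals into `K`.
  by_contra hcon
  push Not at hcon
  obtain ⟨m, hm, hbd⟩ := exists_ord_bound (E := E) (bUnion E (upair E t a) (upair E b b))
  have htm := hbd t ht (mem_bUnion.2 (.inl (mem_upair.2 (.inl rfl))))
  have ham := hbd a ha (mem_bUnion.2 (.inl (mem_upair.2 (.inr rfl))))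
  have hbm := hbd b hb (mem_bUnion.2 (.inr (mem_upair.2 (.inl rfl))))
  let F (t a b : V) : V := W p (opair E t (opair E a (opair E (enum E W p a) (enum E W p b))))
  have hF {n : ℕ} (f g h : (Fin n → V) → V) [DfnFun (fullSys E) f] [DfnFun (fullSys E) g]
      [DfnFun (fullSys E) h] : DfnFun (fullSys E) fun v => F (f v) (g v) (h v) := by
    simp only [F]; infer_instance
  have h1 (t a : V) : IsSet E fun z => ∃ b, E b (succ E m) ∧ z = F t a b :=
    isSet_image (E := E) (succ E m) fun b => F t a b
  have h2 (t : V) : IsSet E fun z => ∃ a, E a (succ E m) ∧ ∃ b, E b (succ E m) ∧ z = F t a b := by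
    obtain ⟨y, hy⟩ := isSet_iUnion (E := E) (succ E m) fun a =>
      cls E fun z => ∃ b, E b (succ E m) ∧ z = F t a b
    exact ⟨y, fun z => (hy z).trans (by simp only [mem_cls (h1 t _)])⟩
  have h3 : IsSet E fun z => ∃ t, E t (succ E m) ∧
      ∃ a, E a (succ E m) ∧ ∃ b, E b (succ E m) ∧ z = F t a b := by
    obtain ⟨y, hy⟩ := isSet_iUnion (E := E) (succ E m) fun t =>
      cls E fun z => ∃ a, E a (succ E m) ∧ ∃ b, E b (succ E m) ∧ z = F t a b
    exact ⟨y, fun z => (hy z).trans (by simp only [mem_cls (h2 _)])⟩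
  obtain ⟨K, hK⟩ := h3
  have hle {c x : V} (hx : IsOrd E x) (hmx : E m x) (hc : E c (succ E m)) : E c x := by
    rcases mem_succ.1 hc with hc | rfl
    exacts [hx.trans hmx hc, hmx]
  have key (x : V) (hx : IsOrd E x) (hmx : E m x) :
      E (enum E W p x) K ∧ ∀ y, E y x → enum E W p y ≠ enum E W p x := by
    have hcand {t a b : V} (ha : E a x) (hb : E b x) :
        candidate E W p (hist E (enumStep E W) p x) t a b = F t a b := by
      rw [candidate, app_hist_enum hx ha, app_hist_enum hx hb]
    have hf : Fresh E W p (hist E (enumStep E W) p x) m t a b := by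
      refine ⟨mem_succ.2 (.inl htm), mem_succ.2 (.inl ham), mem_succ.2 (.inl hbm), fun y hy => ?_⟩
      rw [opair_mem_hist hx, hcand (hx.trans hmx ham) (hx.trans hmx hbm)] at hy
      exact hcon y (hx.mem hy.1) hy.2.symm
    obtain ⟨m', t', a', b', h', hm'⟩ := exists_firstFresh hm hf
    have hs {c : V} (hc : E c (succ E m')) : E c (succ E m) := by
      rcases mem_succ.1 hc with hc | rfl
      exacts [hm.succ.trans hm' hc, hm']
    have hf' := h'.2.2.2.2.1
    have hx' : enum E W p x = F t' a' b' :=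
      h'.enumStep_eq.trans (hcand (hle hx hmx (hs hf'.2.1)) (hle hx hmx (hs hf'.2.2.1)))
    refine ⟨(hK _).2 ⟨t', hs hf'.1, a', hs hf'.2.1, b', hs hf'.2.2.1, hx'⟩, fun y hy hyx => ?_⟩
    refine hf'.2.2.2 y ?_
    rw [opair_mem_hist hx]
    exact ⟨hy, (h'.enumStep_eq.symm.trans hyx.symm)⟩
  exact not_injOn_ordinals (fun x => enum E W p x) hm K (fun x hx hmx => (key x hx hmx).1)
    fun x y hx hmx hxy hy h => (key y hy (hy.trans hxy hmx)).2 x hxy h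

end Enumeration

/-! ### The generating operations and the closure they produce. -/

section Operations

variable {V : Type*} {E : V → V → Prop} {n : ℕ} {𝔇 : DefSys E} [ZF E]

variable (E)

/-- The Cartesian product. -/
noncomputable def prod (b c : V) : V := cls E fun z => ∃ x, E x b ∧ ∃ y, E y c ∧ z = opair E x y

/-- The difference of two sets. -/
noncomputable def diff (b c : V) : V := cls E fun z => E z b ∧ ¬ E z c

/-- The domain of a relation. -/
noncomputable def dom (g : V) : V := cls E fun x => ∃ y, E (opair E x y) g

/-- The range of a relation. -/
noncomputable def ran (g : V) : V := cls E fun y => ∃ x, E (opair E x y) g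

/-- The set of all `e` with `f(e) ∈ g(e)`. -/
noncomputable def memLocus (f g : V) : V :=
  cls E fun e => ∃ a, E (opair E e a) f ∧ ∃ b, E (opair E e b) g ∧ E a b

/-- The first projection from a set of ordered pairs. -/
noncomputable def fstOn (b : V) : V :=
  cls E fun q => ∃ x e, E (opair E x e) b ∧ q = opair E (opair E x e) x

/-- The composition of the second projection from a set of ordered pairs with a relation. -/
noncomputable def compSnd (b c : V) : V :=
  cls E fun q => ∃ x e a, E (opair E x e) b ∧ E (opair E e a) c ∧ q = opair E (opair E x e) a

section

variable {E} (f g : (Fin n → V) → V) [DfnFun 𝔇 f] [DfnFun 𝔇 g]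

instance DfnFun.prod : DfnFun 𝔇 fun v => prod E (f v) (g v) := by
  unfold SetModel.prod; infer_instance

instance DfnFun.diff : DfnFun 𝔇 fun v => diff E (f v) (g v) := by
  unfold SetModel.diff; infer_instance

instance DfnFun.dom : DfnFun 𝔇 fun v => dom E (f v) := by unfold SetModel.dom; infer_instance

instance DfnFun.ran : DfnFun 𝔇 fun v => ran E (f v) := by unfold SetModel.ran; infer_instance

instance DfnFun.memLocus : DfnFun 𝔇 fun v => memLocus E (f v) (g v) := by
  unfold SetModel.memLocus; infer_instance

instance DfnFun.fstOn : DfnFun 𝔇 fun v => fstOn E (f v) := by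
  unfold SetModel.fstOn; infer_instance

instance DfnFun.compSnd : DfnFun 𝔇 fun v => compSnd E (f v) (g v) := by
  unfold SetModel.compSnd; infer_instance

end

variable {E}

theorem mem_prod {b c z : V} : E z (prod E b c) ↔ ∃ x, E x b ∧ ∃ y, E y c ∧ z = opair E x y := by
  have h1 (x : V) : IsSet E fun z => ∃ y, E y c ∧ z = opair E x y :=
    isSet_image (E := E) c fun y => opair E x y
  obtain ⟨y, hy⟩ := isSet_iUnion (E := E) b fun x => cls E fun z => ∃ y, E y c ∧ z = opair E x y
  exact mem_cls ⟨y, fun z => (hy z).trans (by simp only [mem_cls (h1 _)])⟩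

theorem opair_mem_prod {b c x y : V} : E (opair E x y) (prod E b c) ↔ E x b ∧ E y c := by
  simp [mem_prod, opair_inj]

theorem mem_diff {b c z : V} : E z (diff E b c) ↔ E z b ∧ ¬ E z c := mem_cls (isSet_sep b _)

theorem mem_dom {g x : V} : E x (dom E g) ↔ ∃ y, E (opair E x y) g :=
  mem_cls (IsSet.mono (isSet_mem _) fun _ ⟨_, h⟩ => (mem_sUnion_sUnion_of_opair h).1)

theorem mem_ran {g y : V} : E y (ran E g) ↔ ∃ x, E (opair E x y) g :=
  mem_cls (IsSet.mono (isSet_mem _) fun _ ⟨_, h⟩ => (mem_sUnion_sUnion_of_opair h).2)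

theorem mem_memLocus {f g e : V} :
    E e (memLocus E f g) ↔ ∃ a, E (opair E e a) f ∧ ∃ b, E (opair E e b) g ∧ E a b :=
  mem_cls (IsSet.mono (isSet_mem _) fun _ ⟨_, h, _⟩ => (mem_sUnion_sUnion_of_opair h).1)

theorem mem_fstOn {b q : V} :
    E q (fstOn E b) ↔ ∃ x e, E (opair E x e) b ∧ q = opair E (opair E x e) x := by
  refine mem_cls (IsSet.mono (isSet_mem (prod E b (sUnion E (sUnion E b)))) ?_)
  rintro _ ⟨x, e, h, rfl⟩
  exact opair_mem_prod.2 ⟨h, (mem_sUnion_sUnion_of_opair h).1⟩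

theorem mem_compSnd {b c q : V} : E q (compSnd E b c) ↔
    ∃ x e a, E (opair E x e) b ∧ E (opair E e a) c ∧ q = opair E (opair E x e) a := by
  refine mem_cls (IsSet.mono (isSet_mem (prod E b (sUnion E (sUnion E c)))) ?_)
  rintro _ ⟨x, e, a, h, h', rfl⟩
  exact opair_mem_prod.2 ⟨h, (mem_sUnion_sUnion_of_opair h').2⟩

variable (E)

/-- The natural numbers of `(V, E)` that have a standard counterpart. -/
noncomputable def num : ℕ → V
  | 0 => emp E
  | k + 1 => succ E (num k)

/-- The generating operations. -/
noncomputable def ops (k : ℕ) (p a b c : V) : V :=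
  match k with
  | 0 => a
  | 1 => p
  | 2 => hier E a
  | 3 => prod E b c
  | 4 => upair E b b
  | 5 => diff E b c
  | 6 => dom E b
  | 7 => ran E b
  | 8 => sUnion E b
  | 9 => memLocus E b c
  | 10 => fstOn E b
  | 11 => compSnd E b c
  | _ => emp E

/-- The generating operations, combined into one. -/
noncomputable def combOp (p q : V) : V :=
  cls E fun z => ∃ t a b c, q = opair E t (opair E a (opair E b c)) ∧
    ∃ k : Fin 12, t = num E k ∧ E z (ops E k p a b c)

variable {E}

instance DfnFun.num : ∀ k : ℕ, DfnFun 𝔇 fun _ : Fin n → V => num E k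
  | 0 => by unfold SetModel.num; infer_instance
  | k + 1 => by have := DfnFun.num k; unfold SetModel.num; infer_instance

instance DfnFun.ops (f₁ f₂ f₃ f₄ : (Fin n → V) → V) [DfnFun 𝔇 f₁] [DfnFun 𝔇 f₂] [DfnFun 𝔇 f₃]
    [DfnFun 𝔇 f₄] (k : ℕ) : DfnFun 𝔇 fun v => ops E k (f₁ v) (f₂ v) (f₃ v) (f₄ v) := by
  match k with
  | 0 | 1 | 2 | 3 | 4 | 5 | 6 | 7 | 8 | 9 | 10 | 11 => simp only [SetModel.ops]; infer_instance
  | _ + 12 => simp only [SetModel.ops]; infer_instance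

instance : DfnFun₂ 𝔇 (combOp E) := ⟨by unfold combOp; infer_instance⟩

theorem isOrd_num : ∀ k : ℕ, IsOrd E (num E k)
  | 0 => isOrd_emp
  | k + 1 => (isOrd_num k).succ

theorem num_mem_num {j k : ℕ} (h : j < k) : E (num E j) (num E k) := by
  induction k with
  | zero => omega
  | succ k ih =>
    refine mem_succ.2 ?_
    rcases Nat.lt_succ_iff_lt_or_eq.1 h with h | rfl
    exacts [.inl (ih h), .inr rfl]

theorem num_inj {j k : ℕ} (h : num E j = num E k) : j = k := by
  rcases lt_trichotomy j k with h' | h' | h'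
  · exact (mem_irrefl _ (h ▸ num_mem_num (E := E) h')).elim
  · exact h'
  · exact (mem_irrefl _ (h ▸ num_mem_num (E := E) h')).elim

theorem combOp_num {k : ℕ} (hk : k < 12) (p a b c : V) :
    combOp E p (opair E (num E k) (opair E a (opair E b c))) = ops E k p a b c := by
  have : ∀ z, E z (ops E k p a b c) ↔ ∃ t a' b' c',
      opair E (num E k) (opair E a (opair E b c)) = opair E t (opair E a' (opair E b' c')) ∧
      ∃ k : Fin 12, t = num E k ∧ E z (ops E k p a' b' c') := by
    refine fun z => ⟨fun h => ⟨_, _, _, _, rfl, ⟨k, hk⟩, rfl, h⟩, ?_⟩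
    rintro ⟨t, a', b', c', h, j, rfl, hz⟩
    simp only [opair_inj] at h
    obtain ⟨h, rfl, rfl, rfl⟩ := h
    rwa [num_inj h]
  exact ext_mem (E := E) fun z => (mem_cls ⟨_, this⟩).trans (this z).symm

variable (E) in
/-- The closure of the class of ordinals and `{p}` under the generating operations. -/
def generated (p : V) : Set V := {x | ∃ a, IsOrd E a ∧ x = enum E (combOp E) p a}

variable {p q x y : V}

/-- Here the closure pays off: unlike membership in `OD`, this is one first-order relation between
an element and the parameter. -/
instance Dfn.generated (f g : (Fin n → V) → V) [DfnFun 𝔇 f] [DfnFun 𝔇 g] :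
    Dfn 𝔇 fun v => f v ∈ generated E (g v) := by
  simp only [SetModel.generated, mem_ofPred_eq]; infer_instance

/-- The operation receives the index `a` as well as the value listed there; this is how ordinals and
levels of the hierarchy enter the closure. -/
theorem ops_enum_mem {k : ℕ} (hk : k < 12) {a b : V} (ha : IsOrd E a) (hb : IsOrd E b) :
    ops E k p a (enum E (combOp E) p a) (enum E (combOp E) p b) ∈ generated E p := by
  obtain ⟨x, hx, h⟩ := exists_enum_eq (W := combOp E) p (isOrd_num k) ha hb
  rw [combOp_num hk] at h
  exact ⟨x, hx, h.symm⟩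

theorem ord_mem_generated {a : V} (ha : IsOrd E a) : a ∈ generated E p :=
  ops_enum_mem (k := 0) (by omega) ha ha

theorem self_mem_generated : p ∈ generated E p :=
  ops_enum_mem (k := 1) (by omega) isOrd_emp isOrd_emp

theorem hier_mem_generated {a : V} (ha : IsOrd E a) : hier E a ∈ generated E p :=
  ops_enum_mem (k := 2) (by omega) ha ha

theorem exists_ops_mem {k : ℕ} (hk : k < 12) (hx : x ∈ generated E p) (hy : y ∈ generated E p) :
    ∃ a, ops E k p a x y ∈ generated E p := by
  obtain ⟨a, ha, rfl⟩ := hx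
  obtain ⟨b, hb, rfl⟩ := hy
  exact ⟨a, ops_enum_mem hk ha hb⟩

theorem prod_mem_generated (hx : x ∈ generated E p) (hy : y ∈ generated E p) :
    prod E x y ∈ generated E p :=
  (exists_ops_mem (k := 3) (by omega) hx hy).elim fun _ h => h

theorem singleton_mem_generated (hx : x ∈ generated E p) : upair E x x ∈ generated E p :=
  (exists_ops_mem (k := 4) (by omega) hx hx).elim fun _ h => h

theorem diff_mem_generated (hx : x ∈ generated E p) (hy : y ∈ generated E p) :
    diff E x y ∈ generated E p :=
  (exists_ops_mem (k := 5) (by omega) hx hy).elim fun _ h => h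

theorem dom_mem_generated (hx : x ∈ generated E p) : dom E x ∈ generated E p :=
  (exists_ops_mem (k := 6) (by omega) hx hx).elim fun _ h => h

theorem ran_mem_generated (hx : x ∈ generated E p) : ran E x ∈ generated E p :=
  (exists_ops_mem (k := 7) (by omega) hx hx).elim fun _ h => h

theorem sUnion_mem_generated (hx : x ∈ generated E p) : sUnion E x ∈ generated E p :=
  (exists_ops_mem (k := 8) (by omega) hx hx).elim fun _ h => h

theorem memLocus_mem_generated (hx : x ∈ generated E p) (hy : y ∈ generated E p) :
    memLocus E x y ∈ generated E p :=
  (exists_ops_mem (k := 9) (by omega) hx hy).elim fun _ h => h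

theorem fstOn_mem_generated (hx : x ∈ generated E p) : fstOn E x ∈ generated E p :=
  (exists_ops_mem (k := 10) (by omega) hx hx).elim fun _ h => h

theorem compSnd_mem_generated (hx : x ∈ generated E p) (hy : y ∈ generated E p) :
    compSnd E x y ∈ generated E p :=
  (exists_ops_mem (k := 11) (by omega) hx hy).elim fun _ h => h

theorem ops_mem_generated (hq : q ∈ generated E p) {a : V} (ha : IsOrd E a)
    (hx : x ∈ generated E p) (hy : y ∈ generated E p) (k : ℕ) :
    ops E k q a x y ∈ generated E p := by
  match k with
  | 0 => exact ord_mem_generated ha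
  | 1 => exact hq
  | 2 => exact hier_mem_generated ha
  | 3 => exact prod_mem_generated hx hy
  | 4 => exact singleton_mem_generated hx
  | 5 => exact diff_mem_generated hx hy
  | 6 => exact dom_mem_generated hx
  | 7 => exact ran_mem_generated hx
  | 8 => exact sUnion_mem_generated hx
  | 9 => exact memLocus_mem_generated hx hy
  | 10 => exact fstOn_mem_generated hx
  | 11 => exact compSnd_mem_generated hx hy
  | _ + 12 => exact ord_mem_generated isOrd_emp

theorem cls_eq_emp {Φ : V → Prop} (h : ∀ z, ¬ Φ z) : cls E Φ = emp E := by
  rw [emp]; congr; funext z; simp [h]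

theorem combOp_mem_generated (hq : q ∈ generated E p) {t a : V} (ha : IsOrd E a)
    (hx : x ∈ generated E p) (hy : y ∈ generated E p) :
    combOp E q (opair E t (opair E a (opair E x y))) ∈ generated E p := by
  by_cases h : ∃ k : Fin 12, t = num E k
  · obtain ⟨k, rfl⟩ := h
    rw [combOp_num k.2]
    exact ops_mem_generated hq ha hx hy k
  · rw [combOp, cls_eq_emp]
    · exact ord_mem_generated isOrd_emp
    · rintro z ⟨t', a', b', c', h', k, ht, -⟩
      exact h ⟨k, by rw [(opair_inj.1 h').1, ht]⟩

/-- Induction on the stage: each value listed from `q` is the operation applied to an ordinal and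
two earlier values, or else a default empty set, and the closure from `p` contains all of these. -/
theorem generated_subset (hq : q ∈ generated E p) : generated E q ⊆ generated E p := by
  rintro _ ⟨x, hx, rfl⟩
  refine ord_induction (fun x => enum E (combOp E) q x ∈ generated E p) ?_ hx
  intro x hx ih
  have happ (a : V) : app E (hist E (enumStep E (combOp E)) q x) a ∈ generated E p := by
    by_cases ha : E a x
    · rw [app_hist_enum hx ha]; exact ih a ha
    · rw [app, cls_eq_emp]
      · exact ord_mem_generated isOrd_emp
      · rintro z ⟨b, hb, -⟩
        rw [opair_mem_hist hx] at hb
        exact ha hb.1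
  by_cases h : ∃ m t a b, FirstFresh E (combOp E) q (hist E (enumStep E (combOp E)) q x) m t a b
  · obtain ⟨m, t, a, b, h⟩ := h
    have h' : enum E (combOp E) q x = candidate E (combOp E) q _ t a b := h.enumStep_eq
    rw [h']
    exact combOp_mem_generated hq h.2.2.1.1 (happ a) (happ b)
  · rw [enum, ordRec, enumStep, cls_eq_emp]
    · exact ord_mem_generated isOrd_emp
    · rintro z ⟨m, t, a, b, h', -⟩
      exact h ⟨m, t, a, b, h'⟩

theorem sUnion_singleton (x : V) : sUnion E (upair E x x) = x :=
  ext_mem (E := E) fun z => by simp [mem_sUnion, mem_upair]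

theorem mem_generated_of_singleton (h : upair E x x ∈ generated E p) : x ∈ generated E p := by
  simpa [sUnion_singleton] using sUnion_mem_generated h

theorem left_mem_generated (h : opair E x y ∈ generated E p) : x ∈ generated E p := by
  refine mem_generated_of_singleton ?_
  convert dom_mem_generated (singleton_mem_generated h)
  exact ext_mem (E := E) fun z => by simp [mem_upair, mem_dom, opair_inj]

theorem right_mem_generated (h : opair E x y ∈ generated E p) : y ∈ generated E p := by
  refine mem_generated_of_singleton ?_
  convert ran_mem_generated (singleton_mem_generated h)
  exact ext_mem (E := E) fun z => by simp [mem_upair, mem_ran, opair_inj]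

theorem inter_mem_generated (hx : x ∈ generated E p) (hy : y ∈ generated E p) :
    diff E x (diff E x y) ∈ generated E p := diff_mem_generated hx (diff_mem_generated hx hy)

theorem mem_inter {x y z : V} : E z (diff E x (diff E x y)) ↔ E z x ∧ E z y := by
  simp [mem_diff]; tauto

/-- The range of `w ∩ ({a} × ran w)` is `{y}`. This recovers a parameter from an enumeration and its
index. -/
theorem value_mem_generated {w a : V} (hw : w ∈ generated E p) (ha : a ∈ generated E p)
    (h : E (opair E a y) w) (h' : ∀ z, E (opair E a z) w → z = y) : y ∈ generated E p := by
  refine mem_generated_of_singleton ?_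
  convert ran_mem_generated (inter_mem_generated hw
    (prod_mem_generated (singleton_mem_generated ha) (ran_mem_generated hw)))
  refine ext_mem (E := E) fun z => ?_
  simp only [mem_upair, mem_ran, mem_inter, opair_mem_prod, or_self]
  constructor
  · rintro rfl; exact ⟨a, h, rfl, a, h⟩
  · rintro ⟨b, h1, rfl, -⟩; exact h' z h1

end Operations

/-! ### Definable sets are generated: induction on formulas. -/

section Coverage

variable {V : Type*} {E : V → V → Prop} {n : ℕ} {𝔇 : DefSys E} [ZF E]

variable (E)

/-- The tuple `xs` as an element of `(V, E)`. -/
noncomputable def env : {n : ℕ} → (Fin n → V) → V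
  | 0, _ => emp E
  | n + 1, xs => opair E (xs (Fin.last n)) (env (Fin.init xs))

/-- The set of all `n`-tuples of elements of the `a`-th level of the cumulative hierarchy. -/
noncomputable def envSet : ℕ → V → V
  | 0, _ => upair E (emp E) (emp E)
  | n + 1, a => prod E (hier E a) (envSet n a)

/-- `s` is the set of all tuples of elements of `Vₐ` that satisfy `P`. -/
def IsLocus (a : V) (P : (Fin n → V) → Prop) (s : V) : Prop :=
  ∀ e, E e s ↔ ∃ xs, (∀ i, E (xs i) (hier E a)) ∧ e = env E xs ∧ P xs

/-- `s` is the graph of the function `F` on the tuples of elements of `Vₐ`. -/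
def IsGraph (a : V) (F : (Fin n → V) → V) (s : V) : Prop :=
  ∀ q, E q s ↔ ∃ xs, (∀ i, E (xs i) (hier E a)) ∧ q = opair E (env E xs) (F xs)

variable {E}

theorem env_inj : ∀ {n : ℕ} {xs ys : Fin n → V}, env E xs = env E ys ↔ xs = ys
  | 0, xs, ys => by simp [Subsingleton.elim xs ys]
  | n + 1, xs, ys => by
    rw [env, env, opair_inj, env_inj]
    refine ⟨fun ⟨h, h'⟩ => ?_, by rintro rfl; simp⟩
    rw [← Fin.snoc_init_self xs, ← Fin.snoc_init_self ys, h, h']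

theorem mem_envSet {a : V} : ∀ {n : ℕ} {e : V},
    E e (envSet E n a) ↔ ∃ xs : Fin n → V, (∀ i, E (xs i) (hier E a)) ∧ e = env E xs
  | 0, e => by simp [envSet, env, mem_upair]
  | n + 1, e => by
    simp only [envSet, mem_prod, mem_envSet, env]
    constructor
    · rintro ⟨x, hx, _, ⟨xs, hxs, rfl⟩, rfl⟩
      exact ⟨Fin.snoc xs x, Fin.lastCases (by simpa) (by simpa), by simp⟩
    · rintro ⟨xs, hxs, rfl⟩
      exact ⟨_, hxs _, _, ⟨Fin.init xs, fun i => hxs _, rfl⟩, rfl⟩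

theorem IsLocus.env_mem {a s : V} {P : (Fin n → V) → Prop} (h : IsLocus E a P s)
    {xs : Fin n → V} : E (env E xs) s ↔ (∀ i, E (xs i) (hier E a)) ∧ P xs := by
  rw [h]
  constructor
  · rintro ⟨ys, hys, h, hP⟩
    obtain rfl := env_inj.1 h
    exact ⟨hys, hP⟩
  · exact fun ⟨h, h'⟩ => ⟨xs, h, rfl, h'⟩

theorem IsGraph.opair_mem {a s : V} {F : (Fin n → V) → V} (h : IsGraph E a F s)
    {xs : Fin n → V} {y : V} :
    E (opair E (env E xs) y) s ↔ (∀ i, E (xs i) (hier E a)) ∧ y = F xs := by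
  rw [h]
  constructor
  · rintro ⟨ys, hys, h⟩
    obtain ⟨h, h'⟩ := opair_inj.1 h
    obtain rfl := env_inj.1 h
    exact ⟨hys, h'⟩
  · rintro ⟨h, rfl⟩
    exact ⟨xs, h, rfl⟩

variable (E) in
/-- All sets of tuples from levels of the hierarchy that `P` defines are generated from `p`. -/
def HasLocus (p : V) (P : (Fin n → V) → Prop) : Prop :=
  ∀ a, IsOrd E a → ∃ s ∈ generated E p, IsLocus E a P s

variable (E) in
/-- All restrictions of `F` to levels of the hierarchy are generated from `p`. -/
def HasGraph (p : V) (F : (Fin n → V) → V) : Prop :=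
  ∀ a, IsOrd E a → ∃ s ∈ generated E p, IsGraph E a F s

variable {p : V}

theorem envSet_mem_generated {a : V} (ha : IsOrd E a) : ∀ n : ℕ, envSet E n a ∈ generated E p
  | 0 => singleton_mem_generated (ord_mem_generated isOrd_emp)
  | n + 1 => prod_mem_generated (hier_mem_generated ha) (envSet_mem_generated ha n)

theorem hasGraph_const {c : V} (hc : c ∈ generated E p) : HasGraph E p fun _ : Fin n → V => c := by
  intro a ha
  refine ⟨_, prod_mem_generated (envSet_mem_generated ha n) (singleton_mem_generated hc),
    fun q => ?_⟩
  simp only [mem_prod, mem_envSet, mem_upair]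
  constructor
  · rintro ⟨_, ⟨xs, h, rfl⟩, _, rfl | rfl, rfl⟩ <;> exact ⟨xs, h, rfl⟩
  · rintro ⟨xs, h, rfl⟩
    exact ⟨_, ⟨xs, h, rfl⟩, c, .inl rfl, rfl⟩

/-- Tuples are coded with the last entry outermost: it is a first projection, and the other entries
come from composing with the second projection. -/
theorem hasGraph_var : ∀ {n : ℕ} (i : Fin n), HasGraph E p fun xs : Fin n → V => xs i
  | n + 1, i => by
    intro a ha
    have hS := envSet_mem_generated (p := p) ha (n + 1)
    induction i using Fin.lastCases with
    | last =>
      refine ⟨_, fstOn_mem_generated hS, fun q => ?_⟩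
      simp only [mem_fstOn, mem_envSet]
      constructor
      · rintro ⟨x, e, ⟨xs, h, h'⟩, rfl⟩
        rw [env, opair_inj] at h'
        obtain ⟨rfl, rfl⟩ := h'
        exact ⟨xs, h, rfl⟩
      · rintro ⟨xs, h, rfl⟩
        exact ⟨_, _, ⟨xs, h, rfl⟩, rfl⟩
    | cast i =>
      obtain ⟨f, hf, hf'⟩ := hasGraph_var i a ha
      refine ⟨_, compSnd_mem_generated hS hf, fun q => ?_⟩
      simp only [mem_compSnd, mem_envSet]
      constructor
      · rintro ⟨x, e, b, ⟨xs, h, h'⟩, hb, rfl⟩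
        rw [env, opair_inj] at h'
        obtain ⟨rfl, rfl⟩ := h'
        rw [hf'.opair_mem] at hb
        exact ⟨xs, h, by rw [hb.2]; rfl⟩
      · rintro ⟨xs, h, rfl⟩
        exact ⟨_, _, _, ⟨xs, h, rfl⟩, hf'.opair_mem.2 ⟨fun i => h _, rfl⟩, rfl⟩

theorem hasLocus_eq {F G : (Fin n → V) → V} (hF : HasGraph E p F) (hG : HasGraph E p G) :
    HasLocus E p fun xs => F xs = G xs := by
  intro a ha
  obtain ⟨f, hf, hf'⟩ := hF a ha
  obtain ⟨g, hg, hg'⟩ := hG a ha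
  refine ⟨_, dom_mem_generated (inter_mem_generated hf hg), fun e => ?_⟩
  simp only [mem_dom, mem_inter]
  constructor
  · rintro ⟨y, hy, hy'⟩
    obtain ⟨xs, h, h'⟩ := (hf' _).1 hy
    obtain ⟨rfl, rfl⟩ := opair_inj.1 h'
    exact ⟨xs, h, rfl, (hg'.opair_mem.1 hy').2⟩
  · rintro ⟨xs, h, rfl, h'⟩
    exact ⟨F xs, hf'.opair_mem.2 ⟨h, rfl⟩, hg'.opair_mem.2 ⟨h, h'⟩⟩

theorem hasLocus_mem {F G : (Fin n → V) → V} (hF : HasGraph E p F) (hG : HasGraph E p G) :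
    HasLocus E p fun xs => E (F xs) (G xs) := by
  intro a ha
  obtain ⟨f, hf, hf'⟩ := hF a ha
  obtain ⟨g, hg, hg'⟩ := hG a ha
  refine ⟨_, memLocus_mem_generated hf hg, fun e => ?_⟩
  rw [mem_memLocus (E := E)]
  constructor
  · rintro ⟨y, hy, z, hz, hyz⟩
    obtain ⟨xs, h, h'⟩ := (hf' _).1 hy
    obtain ⟨rfl, rfl⟩ := opair_inj.1 h'
    obtain ⟨-, rfl⟩ := hg'.opair_mem.1 hz
    exact ⟨xs, h, rfl, hyz⟩
  · rintro ⟨xs, h, rfl, h'⟩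
    exact ⟨F xs, hf'.opair_mem.2 ⟨h, rfl⟩, _, hg'.opair_mem.2 ⟨h, rfl⟩, h'⟩

theorem hasLocus_false : HasLocus E p fun _ : Fin n → V => False := fun _ _ =>
  ⟨_, ord_mem_generated isOrd_emp, fun e => by simp [not_mem_emp]⟩

theorem hasLocus_imp {P Q : (Fin n → V) → Prop} (hP : HasLocus E p P) (hQ : HasLocus E p Q) :
    HasLocus E p fun xs => P xs → Q xs := by
  intro a ha
  obtain ⟨s, hs, hs'⟩ := hP a ha
  obtain ⟨t, ht, ht'⟩ := hQ a ha
  refine ⟨_, diff_mem_generated (envSet_mem_generated ha n) (diff_mem_generated hs ht),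
    fun e => ?_⟩
  simp only [mem_diff, mem_envSet]
  constructor
  · rintro ⟨⟨xs, h, rfl⟩, h'⟩
    rw [hs'.env_mem, ht'.env_mem] at h'
    exact ⟨xs, h, rfl, by tauto⟩
  · rintro ⟨xs, h, rfl, h'⟩
    rw [hs'.env_mem, ht'.env_mem]
    exact ⟨⟨xs, h, rfl⟩, by tauto⟩

instance DfnFun.env : ∀ {m : ℕ} (f : Fin m → (Fin n → V) → V) [∀ i, DfnFun 𝔇 (f i)],
    DfnFun 𝔇 fun v => env E fun i => f i v
  | 0, _, _ => by simp only [SetModel.env]; infer_instance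
  | m + 1, f, _ => by
    have := DfnFun.env fun i : Fin m => f i.castSucc
    simp only [SetModel.env, Fin.init_def]
    infer_instance

/-- The arity is an external number, so quantifying over a tuple amounts to finitely many
quantifiers. -/
theorem dfn_env {m : ℕ} (P : (Fin m → V) → Prop) [hP : Dfn (fullSys E) P] :
    Dfn (fullSys E) fun v : Fin 1 → V => ∃ xs, v 0 = env E xs ∧ P xs := by
  let := memStructure E
  have h : Dfn (fullSys E) fun w : Fin (1 + m) → V =>
      w (Fin.castAdd m 0) = env E (fun i => w (Fin.natAdd 1 i)) ∧
        P fun i => w (Fin.natAdd 1 i) := by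
    have : Dfn (fullSys E) fun w : Fin (1 + m) → V => P fun i => w (Fin.natAdd 1 i) :=
      ⟨(fullSys E).subst _ hP.out⟩
    infer_instance
  have h' : (univ : Set V).Definable langMem _ := h.out
  have := (h'.preimage_comp (finSumFinEquiv (m := 1) (n := m)).symm).exists_of_finite
  refine ⟨show (univ : Set V).Definable langMem _ from ?_⟩
  convert this using 4
  simp

/-- The quantifier ranges over all of `V`, while a locus sees only one level. Collection gives `l`
such that each tuple from `Vₐ` with a counterexample has one in `V_l`. Above `a` and `l`, the
complement of the locus of `P` projects, by dropping the outermost entry, onto a set that contains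
exactly the failing tuples from `Vₐ`. -/
theorem hasLocus_all {P : (Fin (n + 1) → V) → Prop} [hd : Dfn (fullSys E) P]
    (hP : HasLocus E p P) : HasLocus E p fun xs : Fin n → V => ∀ x, P (Fin.snoc xs x) := by
  intro a ha
  have hd : Dfn (fullSys E) fun xs => ¬ P xs := inferInstance
  have h1 {k : ℕ} (f : (Fin k → V) → V) [DfnFun (fullSys E) f] :
      Dfn (fullSys E) fun v => ∃ xs, f v = env E xs ∧ ¬ P xs :=
    Dfn.comp₁ (fun e => ∃ xs, e = env E xs ∧ ¬ P xs) (dfn_env fun xs => ¬ P xs) f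
  obtain ⟨y, hy⟩ := isSet_sep (E := E) (envSet E n a) fun e =>
    ∃ x, ∃ xs, opair E x e = env E xs ∧ ¬ P xs
  obtain ⟨l, hl, hl'⟩ := collection (fullSys E) (fun e c =>
      ∃ x, E x (hier E c) ∧ ∃ xs, opair E x e = env E xs ∧ ¬ P xs) y fun e he => by
    obtain ⟨-, x, h⟩ := (hy e).1 he
    obtain ⟨c, hc, hc'⟩ := exists_mem_hier (E := E) x
    exact ⟨c, hc, x, hc', h⟩
  obtain ⟨m, hm, hm'⟩ := exists_ord_bound (E := E) (upair E a l)
  have ham := hm' a ha (mem_upair.2 (.inl rfl))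
  have hlm := hm' l hl (mem_upair.2 (.inr rfl))
  obtain ⟨s, hs, hs'⟩ := hP m hm
  refine ⟨_, diff_mem_generated (envSet_mem_generated ha n) (ran_mem_generated
    (diff_mem_generated (envSet_mem_generated hm (n + 1)) hs)), fun e => ?_⟩
  simp only [mem_diff, mem_ran, not_exists, not_and_not_right]
  rw [mem_envSet (E := E)]
  constructor
  · rintro ⟨⟨xs, hxs, rfl⟩, h⟩
    refine ⟨xs, hxs, rfl, by_contra fun hcon => ?_⟩
    push Not at hcon
    obtain ⟨x, hx⟩ := hcon
    have hsn (x : V) : opair E x (env E xs) = env E (Fin.snoc xs x : Fin (n + 1) → V) := by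
      simp [env]
    obtain ⟨c, hc, x, hxc, ys, h1, h2⟩ := hl' (env E xs) ((hy _).2
      ⟨mem_envSet.2 ⟨xs, hxs, rfl⟩, x, _, hsn x, hx⟩)
    have hmem : ∀ i, E ((Fin.snoc xs x : Fin (n + 1) → V) i) (hier E m) :=
      Fin.lastCases (by simpa using hier_mono_mem hm hlm (hier_mono_mem hl hc hxc))
        fun i => by simpa using hier_mono_mem hm ham (hxs i)
    have := h x (mem_envSet.2 ⟨_, hmem, hsn x⟩)
    rw [hsn, hs'.env_mem] at this
    rw [hsn, env_inj] at h1
    exact h2 (h1 ▸ this.2)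
  · rintro ⟨xs, hxs, rfl, h⟩
    refine ⟨⟨xs, hxs, rfl⟩, fun x hx => ?_⟩
    obtain ⟨ys, hys, h'⟩ := mem_envSet.1 hx
    rw [h', hs'.env_mem]
    rw [env, opair_inj, env_inj] at h'
    refine ⟨hys, ?_⟩
    rw [← Fin.snoc_init_self ys, ← h'.2, ← h'.1]
    exact h x

section Formulas

variable {α : Type*} {v : α → V}

theorem hasGraph_term (hv : ∀ a, v a ∈ generated E p) (t : langMem.Term (α ⊕ Fin n)) : letI := memStructure E
    HasGraph E p fun xs => t.realize (Sum.elim v xs) := by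
  let := memStructure E
  match t with
  | .var (.inl a) => exact hasGraph_const (hv a)
  | .var (.inr i) => exact hasGraph_var i
  | .func f _ => exact Empty.elim f

theorem hasLocus_realize (hv : ∀ a, v a ∈ generated E p) (φ : langMem.BoundedFormula α n) : letI := memStructure E
    HasLocus E p fun xs => φ.Realize v xs := by
  let := memStructure E
  induction φ with
  | falsum => exact hasLocus_false
  | equal t₁ t₂ => exact hasLocus_eq (hasGraph_term hv t₁) (hasGraph_term hv t₂)
  | rel R ts =>
    cases R
    exact hasLocus_mem (hasGraph_term hv (ts 0)) (hasGraph_term hv (ts 1))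
  | imp φ ψ h h' => exact hasLocus_imp h h'
  | all φ h =>
    have := dfn_realize (E := E) v φ
    exact hasLocus_all h

end Formulas

/-- Whatever is definable from generated parameters is generated. -/
theorem mem_generated_of_definable {A : Set V} (hA : A ⊆ generated E p) {x : V}
    (hx : letI := memStructure E; A.Definable₁ langMem {x}) : x ∈ generated E p := by
  let := memStructure E
  obtain ⟨φ, hφ⟩ := definable_iff_exists_formula_sum.1 hx
  let ψ : langMem.BoundedFormula A 1 := BoundedFormula.relabel (n := 1) (k := 0) id φ
  have hψ (xs : Fin 1 → V) : ψ.Realize (fun a : A => (a : V)) xs ↔ xs 0 = x := by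
    have := Set.ext_iff.1 hφ xs
    simp only [mem_ofPred_eq, mem_singleton_iff] at this
    rw [this]
    refine (BoundedFormula.realize_relabel (m := 1) (n := 0)).trans ?_
    rw [Formula.Realize]
    refine iff_of_eq (congr_arg₂ _ ?_ (Subsingleton.elim _ _))
    rfl
  obtain ⟨a, ha, hxa⟩ := exists_mem_hier (E := E) x
  obtain ⟨s, hs, hs'⟩ := hasLocus_realize (fun a : A => hA a.2) ψ a ha
  refine mem_generated_of_singleton ?_
  -- A tuple of length one is coded as `(x, ∅)`, so the domain of the locus is `{x}`.
  convert dom_mem_generated hs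
  refine ext_mem (E := E) fun z => ?_
  simp only [mem_upair, mem_dom, or_self]
  constructor
  · rintro rfl
    exact ⟨emp E, (hs' _).2 ⟨fun _ => z, fun _ => hxa, rfl, (hψ _).2 rfl⟩⟩
  · rintro ⟨y, hy⟩
    obtain ⟨xs, -, h, h'⟩ := (hs' _).1 hy
    rw [env, opair_inj] at h
    exact h.1.trans ((hψ xs).1 h')

end Coverage

/-! ### Absoluteness of pairs and ordinals for transitive classes. -/

section Absoluteness

variable {V : Type*} {E : V → V → Prop} {M : Set V}

theorem isPair_restrict (hM : ∀ x ∈ M, ∀ y, E y x → y ∈ M) {p a b : M} :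
    IsPair (restrict E M) p a b ↔ IsPair E (p : V) a b := by
  constructor
  · intro h z
    constructor
    · intro hz
      simpa [Subtype.ext_iff] using (h ⟨z, hM p p.2 z hz⟩).1 hz
    · rintro (rfl | rfl)
      exacts [(h a).2 (.inl rfl), (h b).2 (.inr rfl)]
  · intro h z
    rw [Subtype.ext_iff, Subtype.ext_iff]
    exact h z

theorem isOrderedPair_restrict (hM : ∀ x ∈ M, ∀ y, E y x → y ∈ M) {p a b : M} :
    IsOrderedPair (restrict E M) p a b ↔ IsOrderedPair E (p : V) a b := by
  simp only [IsOrderedPair, isPair_restrict hM]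
  constructor
  · rintro ⟨s, t, h⟩
    exact ⟨s, t, h⟩
  · rintro ⟨s, t, hs, ht, h⟩
    exact ⟨⟨s, hM p p.2 s ((h s).2 (.inl rfl))⟩, ⟨t, hM p p.2 t ((h t).2 (.inr rfl))⟩, hs, ht, h⟩

theorem isTransSet_restrict (hM : ∀ x ∈ M, ∀ y, E y x → y ∈ M) {a : M} :
    IsTransSet (restrict E M) a ↔ IsTransSet E (a : V) :=
  ⟨fun h x hx y hy => h ⟨x, hM a a.2 x hx⟩ hx ⟨y, hM x (hM a a.2 x hx) y hy⟩ hy,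
    fun h x hx y hy => h x hx y hy⟩

theorem isOrd_restrict (hM : ∀ x ∈ M, ∀ y, E y x → y ∈ M) {a : M} :
    IsOrd (restrict E M) a ↔ IsOrd E (a : V) := by
  simp only [IsOrd, isTransSet_restrict hM]
  exact and_congr_right fun _ => ⟨fun h x hx => h ⟨x, hM a a.2 x hx⟩ hx, fun h x hx => h x hx⟩

theorem coe_opair [ZF E] [ZF (restrict E M)] (hM : ∀ x ∈ M, ∀ y, E y x → y ∈ M) (a b : M) :
    ((opair (restrict E M) a b : M) : V) = opair E a b :=
  isOrderedPair_iff.1 ((isOrderedPair_restrict hM).1 (isOrderedPair_iff.2 rfl))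

end Absoluteness

/-! ### Choice functions in HOD(X). -/

section HereditarilyDefinable

variable {V : Type*} {E : V → V → Prop} {n : ℕ} {X : Set V}

/-- An element of `OD` is a definable function of no variables, so instance search can prove closure
of `OD` under definable operations. -/
theorem mem_OD_iff {a : V} :
    a ∈ OD E X ↔ DfnFun (paramSys E (ordinals E ∪ X)) fun _ : Fin 0 → V => a :=
  ⟨fun h => ⟨⟨h⟩⟩, fun h => h.out.out⟩

theorem dfnFun_of_mem_OD {a : V} (ha : a ∈ OD E X) :
    DfnFun (paramSys E (ordinals E ∪ X)) fun _ : Fin n → V => a :=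
  have := mem_OD_iff.1 ha
  DfnFun.subst (fun _ : Fin 0 → V => a) Fin.elim0

theorem mem_OD_of_mem {a : V} (ha : a ∈ X) : a ∈ OD E X :=
  mem_OD_iff.2 (paramSys_const _ (.inr ha))

variable [ZF E] {a b : V}

theorem mem_HOD_iff : a ∈ HOD E X ↔ ∀ x, E x (tcl E a) → x ∈ OD E X := by
  simp [HOD, isTclSingleton_iff]

theorem HOD_subset_OD (ha : a ∈ HOD E X) : a ∈ OD E X := mem_HOD_iff.1 ha a (mem_tcl_self a)

theorem HOD_transitive : ∀ a ∈ HOD E X, ∀ b, E b a → b ∈ HOD E X := fun a ha b hb =>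
  mem_HOD_iff.2 fun x hx => mem_HOD_iff.1 ha x (mem_tcl.1 hx _ (isTransSet_tcl a)
    (isTransSet_tcl a a (mem_tcl_self a) b hb))

/-- The element `a` together with the transitive closures of `{y}` for `y ∈ a` forms a transitive
set, so the closure of `{a}` contains nothing else. -/
theorem mem_HOD_of_subset (ha : a ∈ OD E X) (h : ∀ b, E b a → b ∈ HOD E X) : a ∈ HOD E X := by
  obtain ⟨s, hs⟩ := isSet_sep (E := E) (tcl E a) fun z => z = a ∨ ∃ y, E y a ∧ E z (tcl E y)
  have hsub {y : V} (hy : E y a) : E y (tcl E a) := isTransSet_tcl a a (mem_tcl_self a) y hy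
  have htr : IsTransSet E s := by
    intro z hz u hu
    have hz := (hs z).1 hz
    refine (hs u).2 ⟨isTransSet_tcl a z hz.1 u hu, .inr ?_⟩
    rcases hz.2 with rfl | ⟨y, hy, hzy⟩
    exacts [⟨u, hu, mem_tcl_self u⟩, ⟨y, hy, isTransSet_tcl y z hzy u hu⟩]
  refine mem_HOD_iff.2 fun x hx => ?_
  have := mem_tcl.1 hx s htr ((hs a).2 ⟨mem_tcl_self a, .inl rfl⟩)
  rcases ((hs x).1 this).2 with rfl | ⟨y, hy, hxy⟩
  exacts [ha, mem_HOD_iff.1 (h y hy) x hxy]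

theorem upair_mem_HOD (ha : a ∈ HOD E X) (hb : b ∈ HOD E X) : upair E a b ∈ HOD E X := by
  refine mem_HOD_of_subset (mem_OD_iff.2 ?_) fun z hz => ?_
  · have := dfnFun_of_mem_OD (n := 0) (HOD_subset_OD ha)
    have := dfnFun_of_mem_OD (n := 0) (HOD_subset_OD hb)
    infer_instance
  · rcases mem_upair.1 hz with rfl | rfl
    exacts [ha, hb]

theorem opair_mem_HOD (ha : a ∈ HOD E X) (hb : b ∈ HOD E X) : opair E a b ∈ HOD E X :=
  upair_mem_HOD (upair_mem_HOD ha ha) (upair_mem_HOD ha hb)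

/-- A family of nonempty sets in `HOD(X)` has a choice function in `HOD(X)` if the elements of its
members are all generated from a parameter in `OD(X)`. -/
theorem exists_choice_mem_HOD {w x : V} (hw : w ∈ OD E X) (hx : x ∈ HOD E X)
    (hne : ∀ y, E y x → ∃ z, E z y) (hgen : ∀ y, E y x → ∀ z, E z y → z ∈ generated E w) :
    ∃ f ∈ HOD E X, (∀ p, E p f → ∃ y z, E y x ∧ E z y ∧ p = opair E y z) ∧
      ∀ y, E y x → ∃! z, E (opair E y z) f := by
  -- The choice function sends `y` to its element of least index in the enumeration from `w`.
  let Φ : V → Prop := fun q => ∃ y a, E y x ∧ q = opair E y (enum E (combOp E) w a) ∧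
    IsLeastOrd E (fun a => E (enum E (combOp E) w a) y) a
  have hΦ (q : V) : E q (cls E Φ) ↔ Φ q := by
    refine mem_cls (IsSet.mono (isSet_mem (prod E x (sUnion E x))) ?_)
    rintro _ ⟨y, a, hy, rfl, ha⟩
    exact opair_mem_prod.2 ⟨hy, mem_sUnion.2 ⟨y, hy, ha.2.1⟩⟩
  have h1 : ∀ q, E q (cls E Φ) → ∃ y z, E y x ∧ E z y ∧ q = opair E y z := by
    intro q hq
    obtain ⟨y, a, hy, rfl, ha⟩ := (hΦ q).1 hq
    exact ⟨y, _, hy, ha.2.1, rfl⟩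
  refine ⟨cls E Φ, mem_HOD_of_subset (mem_OD_iff.2 ?_) fun q hq => ?_, h1, fun y hy => ?_⟩
  · have (n : ℕ) := dfnFun_of_mem_OD (n := n) (HOD_subset_OD hx)
    have (n : ℕ) := dfnFun_of_mem_OD (n := n) hw
    infer_instance
  · obtain ⟨y, z, hy, hz, rfl⟩ := h1 q hq
    have hy' := HOD_transitive x hx y hy
    exact opair_mem_HOD hy' (HOD_transitive y hy' z hz)
  · obtain ⟨z, hz⟩ := hne y hy
    obtain ⟨a, ha, rfl⟩ := hgen y hy z hz
    obtain ⟨b, hb⟩ := exists_isLeastOrd (fullSys E) (fun a => E (enum E (combOp E) w a) y) ha hz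
    refine ⟨_, (hΦ _).2 ⟨y, b, hy, rfl, hb⟩, fun z' hz' => ?_⟩
    obtain ⟨y', b', -, h, hb'⟩ := (hΦ _).1 hz'
    obtain ⟨rfl, rfl⟩ := opair_inj.1 h
    rw [hb.unique hb']

/-- Both halves of the theorem reduce to finding `w`. Only transitivity of `HOD(X)` is needed to
read the choice function inside it. -/
theorem satisfiesAC_HOD (h : ∀ x ∈ HOD E X, ∃ w ∈ OD E X,
      ∀ y, E y x → ∀ z, E z y → z ∈ generated E w) :
    SatisfiesAC (restrict E (HOD E X)) := by
  rintro ⟨x, hx⟩ hne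
  have hT : ∀ a ∈ HOD E X, ∀ b, E b a → b ∈ HOD E X := HOD_transitive
  obtain ⟨w, hw, hgen⟩ := h x hx
  obtain ⟨f, hf, h1, h2⟩ := exists_choice_mem_HOD hw hx (fun y hy => by
    obtain ⟨z, hz⟩ := hne ⟨y, hT x hx y hy⟩ hy
    exact ⟨z, hz⟩) hgen
  simp only [isOrderedPair_restrict hT, isOrderedPair_iff]
  refine ⟨⟨f, hf⟩, fun p hp => ?_, fun y hy => ?_⟩
  · obtain ⟨y, z, hy, hz, h⟩ := h1 p hp
    have hy' := hT x hx y hy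
    exact ⟨⟨y, hy'⟩, ⟨z, hT y hy' z hz⟩, hy, hz, h⟩
  · obtain ⟨z, hz, hz'⟩ := h2 y hy
    have hp := hT f hf _ hz
    obtain ⟨y', z', hy', hz'', h⟩ := h1 _ hz
    obtain ⟨rfl, rfl⟩ := opair_inj.1 h
    refine ⟨⟨z, hT y y.2 z hz''⟩, ⟨⟨_, hp⟩, hz, rfl⟩, ?_⟩
    rintro u ⟨p, hp, hpu⟩
    refine Subtype.ext (hz' u ?_)
    change E (opair E y u) f
    rw [← hpu]
    exact hp

end HereditarilyDefinable

/-! ### Enumerating a set along the ordinals from choice. -/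

section WellOrdering

variable {V : Type*} {E : V → V → Prop} [ZF E]

/-- If choice holds, then every set is the range of a function on ordinals. -/
theorem exists_enumeration (hAC : SatisfiesAC E) (u : V) :
    ∃ w, (∀ p, E p u → ∃ a, IsOrd E a ∧ E (opair E a p) w) ∧
      ∀ a p q, E (opair E a p) w → E (opair E a q) w → p = q := by
  obtain ⟨x, hx⟩ := isSet_sep (E := E) (pow E u) fun y => ∃ z, E z y
  obtain ⟨f, hf, hf'⟩ := hAC x fun y hy => ((hx y).1 hy).2
  simp only [isOrderedPair_iff, exists_eq_right] at hf hf'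
  -- Each stage chooses an element of `u` not chosen before. If `u` were never exhausted, this would
  -- inject the ordinals into `u`.
  let N : V → V → V := fun _ g => app E f (diff E u (ran E g))
  have : DfnFun₂ (fullSys E) N := ⟨by simp only [N]; infer_instance⟩
  have hrec (a : V) (h : ∃ z, E z (diff E u (ran E (hist E N u a)))) :
      E (ordRec E N u a) (diff E u (ran E (hist E N u a))) := by
    obtain ⟨z, hz, hz'⟩ := hf' (diff E u (ran E (hist E N u a)))
      ((hx _).2 ⟨mem_pow.2 fun z hz => (mem_diff.1 hz).1, h⟩)
    have : ordRec E N u a = z := app_eq fun c => ⟨hz' c, by rintro rfl; exact hz⟩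
    obtain ⟨y, z', -, hzy, h'⟩ := hf _ hz
    obtain ⟨rfl, rfl⟩ := opair_inj.1 h'
    rwa [this]
  by_cases h : ∃ a, IsOrd E a ∧ ¬ ∃ z, E z (diff E u (ran E (hist E N u a)))
  · obtain ⟨a, ha, h⟩ := h
    refine ⟨hist E N u a, fun p hp => ?_, fun b p q hp hq => ?_⟩
    · have hp' : E p (ran E (hist E N u a)) := by_contra fun h' => h ⟨p, mem_diff.2 ⟨hp, h'⟩⟩
      obtain ⟨b, hb⟩ := mem_ran.1 hp'
      exact ⟨b, ha.mem ((opair_mem_hist ha).1 hb).1, hb⟩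
    · rw [((opair_mem_hist ha).1 hp).2, ((opair_mem_hist ha).1 hq).2]
  · push Not at h
    refine (not_injOn_ordinals (fun a => ordRec E N u a) (isOrd_emp (E := E)) u
      (fun a ha _ => (mem_diff.1 (hrec a (h a ha))).1) fun a b _ _ hab hb heq => ?_).elim
    have := (mem_diff.1 (hrec b (h b hb))).2
    exact this (mem_ran.2 ⟨a, (opair_mem_hist hb).2 ⟨hab, heq.symm⟩⟩)

end WellOrdering

/-! ### Parameters from an inner model with choice. -/

section InnerModel

variable {V : Type*} {E : V → V → Prop} [ZF E] {M : Set V}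

/-- A definition uses finitely many parameters. `M` is closed under pairs, and a pair generates both
components, so one parameter can replace them all. -/
theorem IsInnerModel.exists_generated (hM : IsInnerModel E M) {z : V} (hz : z ∈ OD E M) :
    ∃ p ∈ M, z ∈ generated E p := by
  let := memStructure E
  have : ZF (restrict E M) := ⟨hM.satisfiesZF⟩
  obtain ⟨s, hs', hz⟩ := definable_iff_finitely_definable.1 hz
  have hs : (s : Set V) ⊆ M := hs'.trans (union_subset hM.ordinals_subset subset_rfl)
  suffices h : ∃ p ∈ M, (s : Set V) ⊆ generated E p by
    obtain ⟨p, hp, h⟩ := h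
    exact ⟨p, hp, mem_generated_of_definable h hz⟩
  clear hz hs'
  induction s using Finset.cons_induction with
  | empty => exact ⟨emp E, hM.ordinals_subset isOrd_emp, by simp⟩
  | cons a s ha ih =>
    simp only [Finset.coe_cons, insert_subset_iff] at hs ⊢
    obtain ⟨p, hp, h⟩ := ih hs.2
    have hq := self_mem_generated (E := E) (p := opair E p a)
    refine ⟨opair E p a, ?_, right_mem_generated hq,
      h.trans (generated_subset (left_mem_generated hq))⟩
    rw [← coe_opair hM.transitive ⟨p, hp⟩ ⟨a, hs.1⟩]
    exact Subtype.coe_prop _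

theorem IsInnerModel.exists_common_parameter (hM : IsInnerModel E M)
    (hAC : SatisfiesAC (restrict E M)) {x : V} (hx : ∀ z, E z x → z ∈ OD E M) :
    ∃ w ∈ M, ∀ z, E z x → z ∈ generated E w := by
  have : ZF (restrict E M) := ⟨hM.satisfiesZF⟩
  have := predSys_replacement hM
  -- The hierarchy computed in `M` is definable in `V` only with a predicate for `M`; collection for
  -- such formulas is available because `M` is a class of `V`.
  let 𝔐 := DefSys.rel M (predSys E M) (predSys_pred M)
  have hd : Dfn 𝔐 fun v : Fin 2 → M => restrict E M (v 0) (hier (restrict E M) (v 1)) :=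
    inferInstance
  let S : V → V → Prop := fun p a =>
    ∃ (hp : p ∈ M) (ha : a ∈ M), restrict E M ⟨p, hp⟩ (hier (restrict E M) ⟨a, ha⟩)
  have hS : Dfn (predSys E M) fun v : Fin 2 → V => S (v 0) (v 1) :=
    Dfn.congr ⟨hd.out⟩ fun v =>
      ⟨fun ⟨hp, ha, h⟩ => ⟨Fin.forall_fin_two.2 ⟨hp, ha⟩, h⟩, fun ⟨h, h'⟩ => ⟨h 0, h 1, h'⟩⟩
  have hS' {n : ℕ} (f g : (Fin n → V) → V) [DfnFun (predSys E M) f] [DfnFun (predSys E M) g] :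
      Dfn (predSys E M) fun v => S (f v) (g v) := Dfn.comp₂ S hS f g
  obtain ⟨l, hl, h⟩ := collection (predSys E M) (fun z a => ∃ p, S p a ∧ z ∈ generated E p) x
    fun z hz => by
      obtain ⟨p, hp, hzp⟩ := hM.exists_generated (hx z hz)
      obtain ⟨a, ha, h⟩ := exists_mem_hier (E := restrict E M) ⟨p, hp⟩
      exact ⟨a, (isOrd_restrict hM.transitive).1 ha, p, ⟨hp, a.2, h⟩, hzp⟩
  have hlM := hM.ordinals_subset hl
  obtain ⟨w, hw, hw'⟩ := exists_enumeration hAC (hier (restrict E M) ⟨l, hlM⟩)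
  refine ⟨w, w.2, fun z hz => ?_⟩
  obtain ⟨a, ha, p, ⟨hp, haM, hpa⟩, hzp⟩ := h z hz
  refine generated_subset ?_ hzp
  obtain ⟨b, hb, hbp⟩ := hw ⟨p, hp⟩ (hier_mono_mem (E := restrict E M) (a := ⟨a, haM⟩)
    ((isOrd_restrict hM.transitive).2 hl) ha hpa)
  have hcoe (q : M) : restrict E M (opair (restrict E M) b q) w ↔ E (opair E b q) w := by
    rw [← coe_opair hM.transitive]; rfl
  -- The parameter `p` is the value of `w` at the ordinal `b`, hence generated from `w`.
  refine value_mem_generated self_mem_generated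
    (ord_mem_generated ((isOrd_restrict hM.transitive).1 hb)) ((hcoe _).1 hbp) fun q hq => ?_
  have hq' : upair E (b : V) q ∈ M := hM.transitive _ (hM.transitive w w.2 _ hq) _
    (mem_upair.2 (.inr rfl))
  have hqM : q ∈ M := hM.transitive _ hq' q (mem_upair.2 (.inr rfl))
  exact congr_arg Subtype.val (hw' b ⟨q, hqM⟩ ⟨p, hp⟩ ((hcoe _).2 hq) hbp)

end InnerModel

end SetModel

theorem theorem7p3p1 {V : Type*} (E : V → V → Prop) (hV : SetModel.SatisfiesZF E) :
    SetModel.SatisfiesAC (SetModel.restrict E (SetModel.HOD E ∅)) ∧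
    ∀ M : Set V, SetModel.IsInnerModel E M →
      SetModel.SatisfiesAC (SetModel.restrict E M) →
      SetModel.SatisfiesAC (SetModel.restrict E (SetModel.HOD E M)) := by
  have : SetModel.ZF E := ⟨hV⟩
  refine ⟨SetModel.satisfiesAC_HOD fun x hx => ?_, fun M hM hAC =>
    SetModel.satisfiesAC_HOD fun x hx => ?_⟩
  -- The empty set is a dummy parameter: the ordinals are generated from anything.
  · refine ⟨SetModel.emp E, SetModel.mem_OD_iff.2 inferInstance, fun y hy z hz => ?_⟩
    have hz' := SetModel.HOD_subset_OD
      (SetModel.HOD_transitive y (SetModel.HOD_transitive x hx y hy) z hz)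
    refine SetModel.mem_generated_of_definable ?_ hz'
    rintro a (ha | ha)
    exacts [SetModel.ord_mem_generated ha, ha.elim]
  · obtain ⟨w, hw, h⟩ := hM.exists_common_parameter hAC (x := SetModel.sUnion E x) fun z hz => by
      obtain ⟨y, hy, hz⟩ := SetModel.mem_sUnion.1 hz
      exact SetModel.HOD_subset_OD
        (SetModel.HOD_transitive y (SetModel.HOD_transitive x hx y hy) z hz)
    exact ⟨w, SetModel.mem_OD_of_mem hw, fun y hy z hz => h z (SetModel.mem_sUnion.2 ⟨y, hy, hz⟩)⟩
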